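/- Let $q\in L^1_{\mathrm{loc}}(0,\infty)$ be real-valued and suppose that $$q(x)\ \ge\ \frac{\beta}{x^2}-\mu\qquad\text{for a.e. }x>0$$ for some real $\beta>-\tfrac14$ and $\mu\ge 0$. Put $\tau u:=-u''+qu$ and let $\mathfrak D$ be the set of all $u\in L^2(0,\infty)$ (complex-valued) such that $u$ and $u'$ are locally absolutely continuous on $(0,\infty)$ and $\tau u\in L^2(0,\infty)$. Let $T'$ be the operator $T'u=\tau u$ in $L^2(0,\infty)$ whose domain consists of all $u\in\mathfrak D$ with compact support in $(0,\infty)$, and let $T=\overline{T'}$ be the minimal operator. Let $H^1_0(0,\infty)$ be the closure of $C_c^\infty(0,\infty)$ in $H^1(0,\infty)$, and put $$H^1_0((0,\infty);q):=\Big\{u\in H^1_0(0,\infty):\ \int_0^\infty q(x)|u(x)|^2\,dx<\infty\Big\},$$ where the condition means that $q|u|^2$ is integrable. Then: (i) The quadratic form $\mathfrak t'_q[u]=(Tu,u)$, $u\in\operatorname{dom}(T)$, is closable, and its closure $\mathfrak t_q$ is $$\mathfrak t_q[u]=\int_0^\infty|u'(x)|^2\,dx+\int_0^\infty q(x)|u(x)|^2\,dx,\qquad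 \operatorname{dom}(\mathfrak t_q)=H^1_0((0,\infty);q).$$ (ii) The Friedrichs extension $T_F$ of $T$, that is, the unique self-adjoint extension of $T$ associated with the closed form $\mathfrak t_q$, exists and has the domain $$\operatorname{dom}(T_F)=\mathfrak D\cap H^1_0((0,\infty);q).$$ -/

import Mathlib

open MeasureTheory Set Filter Topology
open scoped ContDiff InnerProductSpace

noncomputable section

namespace SturmLiouville

/-! ### Quadratic forms of operators and Friedrichs extensions, in an abstract Hilbert space -/

section Abstract

variable {H : Type*} [NormedAddCommGroup H] [InnerProductSpace ℂ H]

/-- The sesquilinear form `(T u, v)` of an operator `T` (linear in `u`, antilinear in `v`),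
with domain that of `T`. Mathlib's inner product is antilinear in its first argument. -/
def opForm (T : H →ₗ.[ℂ] H) (u v : T.domain) : ℂ := ⟪(v : H), T u⟫_ℂ

/-- The sequence `s` in `dom T` converges to `u` in the sense of the form of `T`:
`s n → u` in `H` and `(T (s n - s m), s n - s m) → 0` as `n, m → ∞`. -/
def FormTendsto (T : H →ₗ.[ℂ] H) (s : ℕ → T.domain) (u : H) : Prop :=
  Tendsto (fun n => (s n : H)) atTop (𝓝 u) ∧
  Tendsto (fun p : ℕ × ℕ => opForm T (s p.1 - s p.2) (s p.1 - s p.2)) atTop (𝓝 0)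

/-- The domain of the closure of the quadratic form `u ↦ (T u, u)`, `u ∈ dom T`. -/
def formClosureDomain (T : H →ₗ.[ℂ] H) : Set H := {u | ∃ s, FormTendsto T s u}

/-- The closure of the form of `T` takes the value `c` at `(u, v)`: whichever sequences of
`dom T` converge to `u` and to `v` in the sense of the form, the values of the form along them
converge to `c`. Only meaningful for `u`, `v` in the domain of the closure. -/
def FormClosureValue (T : H →ₗ.[ℂ] H) (u v : H) (c : ℂ) : Prop :=
  ∀ s r, FormTendsto T s u → FormTendsto T r v →
    Tendsto (fun n => opForm T (s n) (r n)) atTop (𝓝 c)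

/-- `A` is the Friedrichs extension of `T`: the self-adjoint extension of `T` that is associated
with the closure `t` of the form of `T`, so that `u ∈ dom A` and `A u = f` if and only if
`u ∈ dom t` and `t(u, v) = (f, v)` for all `v ∈ dom t`. -/
structure IsFriedrichsExtension [CompleteSpace H] (T A : H →ₗ.[ℂ] H) : Prop where
  le : T ≤ A
  isSelfAdjoint : IsSelfAdjoint A
  mem_graph_iff : ∀ u f : H, (u, f) ∈ A.graph ↔
    u ∈ formClosureDomain T ∧
      ∀ v ∈ formClosureDomain T, FormClosureValue T u v ⟪v, f⟫_ℂ

end Abstract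

/-! ### The Sturm-Liouville expression on the half-line `(0, ∞)` -/

/-- Lebesgue measure on `(0, ∞)`. -/
abbrev halfLine : Measure ℝ := volume.restrict (Ioi (0 : ℝ))

/-- The complex Hilbert space `L²(0, ∞)`. -/
abbrev L2 : Type := Lp ℂ 2 halfLine

/-- `f` is absolutely continuous on every compact subinterval of `(0, ∞)`. -/
def ACloc (f : ℝ → ℂ) : Prop :=
  ∀ a b : ℝ, 0 < a → a ≤ b → AbsolutelyContinuousOnInterval f a b

/-- The differential expression `τ f = -f'' + q f`. -/
def tau (q : ℝ → ℝ) (f : ℝ → ℂ) (x : ℝ) : ℂ := -deriv (deriv f) x + (q x : ℂ) * f x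

/-- The conditions on a function `f` on `(0, ∞)` that define the maximal domain:
`f` and `f'` are locally absolutely continuous, `f` and `τ f` are square integrable. -/
structure MaxDomainFun (q : ℝ → ℝ) (f : ℝ → ℂ) : Prop where
  ac : ACloc f
  diff : DifferentiableOn ℝ f (Ioi 0)
  ac_deriv : ACloc (deriv f)
  memLp : MemLp f 2 halfLine
  memLp_tau : MemLp (tau q f) 2 halfLine

/-- The maximal domain, as a set of elements of `L²(0, ∞)`. -/
def maxDomain (q : ℝ → ℝ) : Set L2 := {u | ∃ f, MaxDomainFun q f ∧ u =ᵐ[halfLine] f}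

/-- On `(0, ∞)`, the function `f` vanishes outside a compact subset of `(0, ∞)`. -/
def CompactlySupported (f : ℝ → ℂ) : Prop :=
  ∃ a b : ℝ, 0 < a ∧ ∀ x, 0 < x → x ∉ Icc a b → f x = 0

lemma ACloc.add {f g : ℝ → ℂ} (hf : ACloc f) (hg : ACloc g) : ACloc (f + g) :=
  fun a b ha hab => (hf a b ha hab).add (hg a b ha hab)

lemma ACloc.smul {f : ℝ → ℂ} (hf : ACloc f) (c : ℂ) : ACloc (c • f) :=
  fun a b ha hab => (hf a b ha hab).const_smul c

lemma ac_of_dist_le {f : ℝ → ℂ} {g : ℝ → ℝ} (h : ∀ x y, dist (g x) (g y) ≤ dist (f x) (f y))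
    {a b : ℝ} (hf : AbsolutelyContinuousOnInterval f a b) :
    AbsolutelyContinuousOnInterval g a b := by
  rw [absolutelyContinuousOnInterval_iff] at hf ⊢
  intro ε hε
  obtain ⟨δ, hδ, H⟩ := hf ε hε
  exact ⟨δ, hδ, fun E hE hl =>
    lt_of_le_of_lt (Finset.sum_le_sum fun i _ => h _ _) (H E hE hl)⟩

lemma ACloc.ae_differentiableAt {f : ℝ → ℂ} (hf : ACloc f) :
    ∀ᵐ x ∂halfLine, DifferentiableAt ℝ f x := by
  have key : ∀ n : ℕ, ∀ᵐ x : ℝ, x ∈ Icc ((1 : ℝ) / (n + 1)) (n + 1) →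
      DifferentiableAt ℝ f x := by
    intro n
    have h0 : (0 : ℝ) < 1 / (n + 1) := by positivity
    have h1 : (1 : ℝ) / (n + 1) ≤ n + 1 := by
      rw [div_le_iff₀ (by positivity)]
      nlinarith [(Nat.cast_nonneg n : (0 : ℝ) ≤ n)]
    have hac := hf _ _ h0 h1
    have hre : AbsolutelyContinuousOnInterval (fun x => (f x).re) (1 / ((n : ℝ) + 1)) (n + 1) := by
      refine ac_of_dist_le (fun x y => ?_) hac
      rw [Real.dist_eq, dist_eq_norm, ← Complex.sub_re]
      exact Complex.abs_re_le_norm _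
    have him : AbsolutelyContinuousOnInterval (fun x => (f x).im) (1 / ((n : ℝ) + 1)) (n + 1) := by
      refine ac_of_dist_le (fun x y => ?_) hac
      rw [Real.dist_eq, dist_eq_norm, ← Complex.sub_im]
      exact Complex.abs_im_le_norm _
    filter_upwards [hre.ae_differentiableAt, him.ae_differentiableAt] with x hxr hxi hx
    rw [uIcc_of_le h1] at hxr hxi
    have e : f = fun x => ((f x).re : ℂ) + ((f x).im : ℂ) * Complex.I := by
      funext y; exact (Complex.re_add_im (f y)).symm
    rw [e]
    exact ((Complex.ofRealCLM.differentiableAt).comp x (hxr hx)).add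
      (((Complex.ofRealCLM.differentiableAt).comp x (hxi hx)).mul_const _)
  rw [← ae_all_iff] at key
  refine (ae_restrict_iff' measurableSet_Ioi).2 ?_
  filter_upwards [key] with x hx hpos
  have hpos : 0 < x := hpos
  obtain ⟨n, hn⟩ := exists_nat_gt (max x (1 / x))
  refine hx n ⟨?_, ?_⟩
  · rw [div_le_iff₀ (by positivity)]
    have h2 : 1 / x < n := lt_of_le_of_lt (le_max_right _ _) hn
    rw [div_lt_iff₀ hpos] at h2
    nlinarith
  · have h2 : x < n := lt_of_le_of_lt (le_max_left _ _) hn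
    linarith

lemma deriv_eqOn_nhds {f g : ℝ → ℂ} (h : EqOn f g (Ioi 0)) : EqOn (deriv f) (deriv g) (Ioi 0) :=
  fun _ hx => (Filter.eventuallyEq_of_mem (Ioi_mem_nhds hx) h).deriv_eq

lemma MaxDomainFun.deriv_add {q : ℝ → ℝ} {f g : ℝ → ℂ} (hf : MaxDomainFun q f)
    (hg : MaxDomainFun q g) : EqOn (deriv (f + g)) (deriv f + deriv g) (Ioi 0) := fun x hx =>
  _root_.deriv_add ((hf.diff x hx).differentiableAt (Ioi_mem_nhds hx))
    ((hg.diff x hx).differentiableAt (Ioi_mem_nhds hx))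

lemma deriv_const_smul' (f : ℝ → ℂ) (c : ℂ) : deriv (c • f) = c • deriv f := by
  funext x
  exact deriv_const_smul_field c f

lemma ACloc.congr {f g : ℝ → ℂ} (hf : ACloc f) (h : EqOn f g (Ioi 0)) : ACloc g := by
  intro a b ha hab
  have hf' := hf a b ha hab
  rw [absolutelyContinuousOnInterval_iff] at hf' ⊢
  intro ε hε
  obtain ⟨δ, hδ, H⟩ := hf' ε hε
  refine ⟨δ, hδ, fun E hE hl => ?_⟩
  have h1 := H E hE hl
  have hmem : ∀ y ∈ uIcc a b, f y = g y := by
    intro y hy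
    rw [uIcc_of_le hab] at hy
    exact h (lt_of_lt_of_le ha hy.1)
  convert! h1 using 1
  refine Finset.sum_congr rfl fun i hi => ?_
  rw [hmem _ (hE.1 i hi).1, hmem _ (hE.1 i hi).2]

lemma MaxDomainFun.tau_add {q : ℝ → ℝ} {f g : ℝ → ℂ} (hf : MaxDomainFun q f)
    (hg : MaxDomainFun q g) : tau q (f + g) =ᵐ[halfLine] tau q f + tau q g := by
  filter_upwards [hf.ac_deriv.ae_differentiableAt, hg.ac_deriv.ae_differentiableAt,
    ae_restrict_mem measurableSet_Ioi] with x h1 h2 hx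
  have e : deriv (deriv (f + g)) x = deriv (deriv f) x + deriv (deriv g) x := by
    rw [deriv_eqOn_nhds (hf.deriv_add hg) hx]
    exact _root_.deriv_add h1 h2
  simp only [tau, Pi.add_apply, e]
  ring

lemma tau_smul (q : ℝ → ℝ) (f : ℝ → ℂ) (c : ℂ) : tau q (c • f) = c • tau q f := by
  funext x
  simp only [tau, deriv_const_smul', Pi.smul_apply, smul_eq_mul]
  ring

lemma MaxDomainFun.add {q : ℝ → ℝ} {f g : ℝ → ℂ} (hf : MaxDomainFun q f)
    (hg : MaxDomainFun q g) : MaxDomainFun q (f + g) where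
  ac := hf.ac.add hg.ac
  diff := hf.diff.add hg.diff
  ac_deriv := (hf.ac_deriv.add hg.ac_deriv).congr (hf.deriv_add hg).symm
  memLp := hf.memLp.add hg.memLp
  memLp_tau := (memLp_congr_ae (hf.tau_add hg)).2 (hf.memLp_tau.add hg.memLp_tau)

lemma MaxDomainFun.smul {q : ℝ → ℝ} {f : ℝ → ℂ} (hf : MaxDomainFun q f) (c : ℂ) :
    MaxDomainFun q (c • f) where
  ac := hf.ac.smul c
  diff := hf.diff.const_smul c
  ac_deriv := by
    rw [deriv_const_smul']
    exact hf.ac_deriv.smul c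
  memLp := hf.memLp.const_smul c
  memLp_tau := by
    rw [tau_smul]
    exact hf.memLp_tau.const_smul c

lemma tau_zero (q : ℝ → ℝ) : tau q 0 = 0 := by
  funext x
  have h : deriv (0 : ℝ → ℂ) = 0 := by
    funext y
    exact deriv_const y (0 : ℂ)
  simp [tau, h]

lemma MaxDomainFun.zero (q : ℝ → ℝ) : MaxDomainFun q 0 := by
  have hd : deriv (0 : ℝ → ℂ) = 0 := by
    funext y
    exact deriv_const y (0 : ℂ)
  have hac : ACloc 0 := fun a b _ _ =>
    (contDiff_const (c := (0 : ℂ)) (n := 1)).contDiffOn.absolutelyContinuousOnInterval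
  exact ⟨hac, differentiableOn_const (0 : ℂ), by rwa [hd], MemLp.zero, by
    rw [tau_zero]; exact MemLp.zero⟩

/-- The graph of the operator `T' u = τ u` whose domain consists of the functions of the maximal
domain that have compact support in `(0, ∞)`. -/
def preminimalGraph (q : ℝ → ℝ) : Submodule ℂ (L2 × L2) where
  carrier := {p | ∃ f, MaxDomainFun q f ∧ CompactlySupported f ∧
    p.1 =ᵐ[halfLine] f ∧ p.2 =ᵐ[halfLine] tau q f}
  zero_mem' := by
    refine ⟨0, MaxDomainFun.zero q, ⟨1, 1, one_pos, fun _ _ _ => rfl⟩, ?_, ?_⟩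
    · exact Lp.coeFn_zero _ _ _
    · rw [tau_zero]
      exact Lp.coeFn_zero _ _ _
  add_mem' := by
    rintro ⟨u, w⟩ ⟨u', w'⟩ ⟨f, hf, ⟨a, b, ha, hab⟩, h1, h2⟩ ⟨g, hg, ⟨a', b', ha', hab'⟩, h1', h2'⟩
    refine ⟨f + g, hf.add hg, ⟨min a a', max b b', lt_min ha ha', fun x hx hn => ?_⟩, ?_, ?_⟩
    · have e1 : f x = 0 := hab x hx fun h =>
        hn ⟨(min_le_left _ _).trans h.1, h.2.trans (le_max_left _ _)⟩
      have e2 : g x = 0 := hab' x hx fun h =>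
        hn ⟨(min_le_right _ _).trans h.1, h.2.trans (le_max_right _ _)⟩
      simp [e1, e2]
    · exact (Lp.coeFn_add u u').trans (h1.add h1')
    · exact (Lp.coeFn_add w w').trans ((h2.add h2').trans (hf.tau_add hg).symm)
  smul_mem' := by
    rintro c ⟨u, w⟩ ⟨f, hf, ⟨a, b, ha, hab⟩, h1, h2⟩
    refine ⟨c • f, hf.smul c, ⟨a, b, ha, fun x hx hn => ?_⟩, ?_, ?_⟩
    · simp [hab x hx hn]
    · exact (Lp.coeFn_smul c u).trans (h1.const_smul c)
    · rw [tau_smul]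
      exact (Lp.coeFn_smul c w).trans (h2.const_smul c)

/-- The operator `T'`. -/
def preminimalOperator (q : ℝ → ℝ) : L2 →ₗ.[ℂ] L2 := (preminimalGraph q).toLinearPMap

lemma ACloc.continuousOn {f : ℝ → ℂ} (hf : ACloc f) : ContinuousOn f (Ioi 0) := by
  intro x hx
  have hx : 0 < x := hx
  have h := (hf (x / 2) (2 * x) (by linarith) (by linarith)).continuousOn
  rw [uIcc_of_le (by linarith)] at h
  exact (h.continuousAt (Icc_mem_nhds (by linarith) (by linarith))).continuousWithinAt

/-- The graph of `T'` is the expected one: `τ f` only depends on the class of `f`. -/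
lemma mem_graph_preminimalOperator (q : ℝ → ℝ) (u w : L2) :
    (u, w) ∈ (preminimalOperator q).graph ↔ ∃ f, MaxDomainFun q f ∧ CompactlySupported f ∧
      u =ᵐ[halfLine] f ∧ w =ᵐ[halfLine] tau q f := by
  have hg : ∀ p ∈ preminimalGraph q, p.1 = 0 → p.2 = 0 := by
    rintro ⟨u, w⟩ ⟨f, hf, -, h1, h2⟩ h
    have h : u = 0 := h
    subst h
    have hf0 : f =ᵐ[halfLine] 0 := h1.symm.trans (Lp.coeFn_zero _ _ _)
    have e0 : EqOn f 0 (Ioi 0) :=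
      Measure.eqOn_open_of_ae_eq hf0 isOpen_Ioi hf.ac.continuousOn continuousOn_const
    have e2 := deriv_eqOn_nhds (deriv_eqOn_nhds e0)
    refine (Lp.ext (h2.trans (EventuallyEq.trans ?_ (Lp.coeFn_zero _ _ _).symm)) : w = 0)
    filter_upwards [ae_restrict_mem measurableSet_Ioi] with x hx
    have := congrFun (tau_zero q) x
    simp only [tau] at this ⊢
    rw [e2 hx, e0 hx, this]
  rw [preminimalOperator, Submodule.toLinearPMap_graph_eq _ hg]
  rfl

/-- The minimal operator `T`, the closure of `T'`. -/
def minimalOperator (q : ℝ → ℝ) : L2 →ₗ.[ℂ] L2 := (preminimalOperator q).closure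

/-! ### The Sobolev space `H¹₀(0, ∞)` -/

/-- The pairs `(φ, φ')` in `L² × L²`, for smooth `φ` with compact support in `(0, ∞)`. -/
def testPairs : Set (L2 × L2) :=
  {p | ∃ φ : ℝ → ℂ, ContDiff ℝ ∞ φ ∧ HasCompactSupport φ ∧ tsupport φ ⊆ Ioi 0 ∧
    p.1 =ᵐ[halfLine] φ ∧ p.2 =ᵐ[halfLine] deriv φ}

/-- `u` belongs to `H¹₀(0, ∞)`, the closure of the test functions in the `H¹` norm, and `u'` is
its weak derivative. -/
def IsH10 (u u' : L2) : Prop := (u, u') ∈ closure testPairs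

/-- The space `H¹₀((0, ∞); q)` of all `u ∈ H¹₀(0, ∞)` with `∫ q |u|² < ∞`; finiteness of the
integral means that `q |u|²` is integrable. -/
def H10q (q : ℝ → ℝ) : Set L2 :=
  {u | (∃ u', IsH10 u u') ∧ Integrable (fun x => q x * ‖u x‖ ^ 2) halfLine}

end SturmLiouville

end

/-! Write `β = γ² - γ` with `γ > 1/2`, which is possible because `β > -1/4`. On `H¹₀(0, ∞)` the
Hardy identity `2 Re (u', u/x) = ‖u/x‖²` gives `‖u' - γ u/x‖² = ‖u'‖² + β ‖u/x‖²`. With `m = √(q + μ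
- β/x²)` the form shifted by `μ + 1` is therefore the sum of squares `‖u‖² + ‖u' - γ u/x‖² + ‖m
u‖²`. Since `γ > 1/2`, the second square controls `‖u'‖`, so the triples `(u, u' - γ u/x, m u)` form
a closed subspace of `L² × L² × L²`. This is a Hilbert space `K`, embedded injectively and densely
in `L²` by the first component `J`, with range `H¹₀((0, ∞); q)`.

The rest of the construction is abstract. The operator `A = (J J*)⁻¹ - (μ + 1)` is self-adjoint and
is the one associated with the form. If `T ≤ A`, each `s ∈ dom T` has a unique lift to `K`, and
convergence in the sense of the form of `T` is convergence of the lifts in `K` (`formTendsto_iff`).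
Closability is thus the injectivity of `J`, and the closure of the form has domain `J(K)` as soon as
the lifts are dense in `K`.

For this density it suffices to approximate the elements of `ran J*`, which is dense. A
weak-derivative argument puts them in the maximal domain (`exists_maxDomainFun`). There they are cut
off by `χₙ(x) = η(log x / (n + 1))` (`mem_closure_preminimalSet`). The only commutator term is `(x
χₙ') (u/x)`, which tends to zero because `x χₙ' = O(1/n)` and `u/x ∈ L²`. Density also yields `dom
A`: for `u` in the maximal domain and in `J(K)`, integration by parts is needed only against
functions of compact support. -/

noncomputable section

namespace SturmLiouville

/-! ### The operator associated with a closed form, and restrictions of it -/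

section FormOperator

variable {H K : Type*} [NormedAddCommGroup H] [InnerProductSpace ℂ H] [CompleteSpace H]
  [NormedAddCommGroup K] [InnerProductSpace ℂ K] [CompleteSpace K]

open ContinuousLinearMap in
/-- The graph of the operator associated with the form `(k, l) ↦ ⟪l, k⟫ - lam * ⟪J l, J k⟫`, where
the form domain `K` is embedded into `H` by `J`. -/
def formOperatorGraph (J : K →L[ℂ] H) (lam : ℝ) : Submodule ℂ (H × H) :=
  LinearMap.ker (((J ∘L adjoint J) ∘L (snd ℂ H H + (lam : ℂ) • fst ℂ H H) - fst ℂ H H :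
    H × H →L[ℂ] H) : H × H →ₗ[ℂ] H)

/-- The operator with graph `formOperatorGraph J lam`. -/
def formOperator (J : K →L[ℂ] H) (lam : ℝ) : H →ₗ.[ℂ] H :=
  (formOperatorGraph J lam).toLinearPMap

open ContinuousLinearMap (adjoint adjoint_inner_left adjoint_inner_right)

variable {J : K →L[ℂ] H} {lam : ℝ}

lemma mem_formOperatorGraph {u f : H} :
    (u, f) ∈ formOperatorGraph J lam ↔ J (adjoint J (f + (lam : ℂ) • u)) = u := by
  simp [formOperatorGraph, LinearMap.mem_ker, sub_eq_zero]

lemma adjoint_injective_of_denseRange (hd : DenseRange J) : Function.Injective (adjoint J) := by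
  rw [injective_iff_map_eq_zero]
  intro f hf
  refine hd.eq_zero_of_inner_left ℂ ?_
  intro k
  rw [← adjoint_inner_left, hf, inner_zero_left]

lemma denseRange_adjoint_of_injective (hJ : Function.Injective J) : DenseRange (adjoint J) := by
  have h := (LinearMap.range (adjoint J : H →ₗ[ℂ] K)).dense_iff_topologicalClosure_eq_top.2 (by
    rw [Submodule.topologicalClosure_eq_top_iff, Submodule.eq_bot_iff]
    intro k hk
    apply hJ
    rw [map_zero, ← inner_self_eq_zero (𝕜 := ℂ), ← adjoint_inner_left]
    exact hk _ ⟨J k, rfl⟩)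
  exact h

/-- A set is dense in `K` if its closure contains all elements that are represented by an element
of `H`. -/
lemma dense_of_forall_represented (hJ : Function.Injective J) {S : Set K}
    (h : ∀ k F, (∀ l, ⟪l, k⟫_ℂ = ⟪J l, F⟫_ℂ) → k ∈ closure S) : Dense S := by
  rw [← dense_closure]
  refine (denseRange_adjoint_of_injective hJ).mono ?_
  rintro _ ⟨F, rfl⟩
  exact h _ F fun l => adjoint_inner_right J l F

variable (hJ : Function.Injective J) (hd : DenseRange J)
include hJ hd

/-- The relation is single-valued: at `u = 0` it says `J (J* f) = 0`, and both `J` and `J*` are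
injective. -/
lemma mem_graph_formOperator {u f : H} :
    (u, f) ∈ (formOperator J lam).graph ↔ J (adjoint J (f + (lam : ℂ) • u)) = u := by
  rw [formOperator, Submodule.toLinearPMap_graph_eq, mem_formOperatorGraph]
  rintro ⟨u, f⟩ h hu
  have hu : u = 0 := hu
  subst hu
  rw [mem_formOperatorGraph, smul_zero, add_zero, ← map_zero J] at h
  exact adjoint_injective_of_denseRange hd ((hJ h).trans (map_zero _).symm)

/-- This is the variational description of the operator. The only candidate for `k` is `J* (f + lam
u)`. -/
lemma mem_graph_formOperator_iff_exists {u f : H} :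
    (u, f) ∈ (formOperator J lam).graph ↔
      ∃ k, J k = u ∧ ∀ l, ⟪l, k⟫_ℂ = ⟪J l, f + (lam : ℂ) • u⟫_ℂ := by
  rw [mem_graph_formOperator hJ hd]
  refine ⟨fun h => ⟨_, h, fun l => adjoint_inner_right _ _ _⟩, ?_⟩
  rintro ⟨k, hk, h⟩
  rw [← hk] at h ⊢
  congr 1
  refine ext_inner_left ℂ fun l => ?_
  rw [adjoint_inner_right, h]

lemma isClosed_formOperator : (formOperator J lam).IsClosed := by
  have : ((formOperator J lam).graph : Set (H × H)) = formOperatorGraph J lam := by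
    ext ⟨u, f⟩
    rw [SetLike.mem_coe, SetLike.mem_coe, mem_graph_formOperator hJ hd, mem_formOperatorGraph]
  rw [LinearPMap.IsClosed, this]
  exact ContinuousLinearMap.isClosed_ker _

lemma dense_domain_formOperator : Dense ((formOperator J lam).domain : Set H) := by
  refine (hd.comp (denseRange_adjoint_of_injective hJ) J.continuous).mono ?_
  rintro _ ⟨f, rfl⟩
  refine LinearPMap.mem_domain_of_mem_graph
    (y := f - (lam : ℂ) • J (adjoint J f)) ((mem_graph_formOperator hJ hd).2 ?_)
  simp

/-- The operator is the inverse of the bounded, injective, self-adjoint `J J*`, shifted by a real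
number. Its graph is parametrized by `z ↦ (J J* z, z - lam J J* z)`, so the adjoint relation can be
tested on these pairs, which is what `key` computes. -/
lemma isSelfAdjoint_formOperator : IsSelfAdjoint (formOperator J lam) := by
  rw [LinearPMap.isSelfAdjoint_def]
  refine LinearPMap.eq_of_eq_graph ?_
  rw [LinearPMap.adjoint_graph_eq_graph_adjoint (dense_domain_formOperator hJ hd)]
  ext ⟨u, f⟩
  rw [mem_graph_formOperator hJ hd, Submodule.mem_adjoint_iff]
  have key : ∀ z : H, ⟪z - (lam : ℂ) • J (adjoint J z), u⟫_ℂ - ⟪J (adjoint J z), f⟫_ℂ =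
      ⟪z, u - J (adjoint J (f + (lam : ℂ) • u))⟫_ℂ := by
    intro z
    have e : ∀ y, ⟪J (adjoint J z), y⟫_ℂ = ⟪z, J (adjoint J y)⟫_ℂ := fun y => by
      rw [← adjoint_inner_right, adjoint_inner_left]
    rw [inner_sub_left, inner_smul_left, Complex.conj_ofReal, e, e, map_add, map_smul, map_add,
      map_smul, inner_sub_right, inner_add_right, inner_smul_right]
    ring
  constructor
  · intro h
    symm
    rw [← sub_eq_zero]
    refine ext_inner_left ℂ fun z => ?_
    rw [← key z, inner_zero_right]
    refine h _ _ ((mem_graph_formOperator hJ hd).2 ?_)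
    simp
  · intro h x y hxy
    rw [mem_graph_formOperator hJ hd] at hxy
    have := key (y + (lam : ℂ) • x)
    rwa [hxy, h, sub_self, inner_zero_right, add_sub_cancel_right] at this

omit hJ hd in
/-- The element of the form domain that represents `s ∈ dom T`, for a restriction `T` of
`formOperator J lam`. -/
def formLift (J : K →L[ℂ] H) (lam : ℝ) (T : H →ₗ.[ℂ] H) : T.domain →ₗ[ℂ] K :=
  (adjoint J : H →ₗ[ℂ] K) ∘ₗ (T.toFun + (lam : ℂ) • T.domain.subtype)

omit hJ hd in
lemma formLift_apply (T : H →ₗ.[ℂ] H) (s : T.domain) :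
    formLift J lam T s = adjoint J (T s + (lam : ℂ) • (s : H)) := rfl

variable {T : H →ₗ.[ℂ] H} (hT : T ≤ formOperator J lam)
include hT

lemma apply_formLift (s : T.domain) : J (formLift J lam T s) = s :=
  (mem_graph_formOperator hJ hd).1 (LinearPMap.le_graph_of_le hT (T.mem_graph s))

lemma opForm_eq (s r : T.domain) : opForm T s r =
    ⟪formLift J lam T r, formLift J lam T s⟫_ℂ - (lam : ℂ) * ⟪(r : H), (s : H)⟫_ℂ := by
  rw [formLift_apply T s, adjoint_inner_right, apply_formLift hJ hd hT, inner_add_right,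
    inner_smul_right, opForm]
  ring

lemma opForm_self_eq (s : T.domain) : opForm T s s =
    ((‖formLift J lam T s‖ ^ 2 - lam * ‖(s : H)‖ ^ 2 : ℝ) : ℂ) := by
  rw [opForm_eq hJ hd hT, inner_self_eq_norm_sq_to_K, inner_self_eq_norm_sq_to_K]
  push_cast
  rfl

omit [InnerProductSpace ℂ H] [CompleteSpace H] hJ hd hT in
lemma cauchySeq_iff_tendsto_norm_sub_sq {a : ℕ → H} : CauchySeq a ↔
    Tendsto (fun p : ℕ × ℕ => ‖a p.1 - a p.2‖ ^ 2) atTop (𝓝 0) := by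
  rw [cauchySeq_iff_tendsto_dist_atTop_0]
  simp only [dist_eq_norm]
  refine ⟨fun h => by simpa using h.pow 2, fun h => ?_⟩
  have := h.sqrt
  simpa using this

/-- The form and the squared norm of the lifts differ by `lam` times the squared norm in `H`, which
tends to zero on differences of a convergent sequence. A form-Cauchy sequence thus has Cauchy lifts,
whose limit in the complete space `K` is mapped by `J` to `u`. -/
lemma formTendsto_iff {s : ℕ → T.domain} {u : H} :
    FormTendsto T s u ↔ ∃ k, J k = u ∧ Tendsto (fun n => formLift J lam T (s n)) atTop (𝓝 k) := by
  have hnorm : (fun p : ℕ × ℕ => opForm T (s p.1 - s p.2) (s p.1 - s p.2)) = fun p =>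
      ((‖formLift J lam T (s p.1) - formLift J lam T (s p.2)‖ ^ 2 -
        lam * ‖(s p.1 : H) - s p.2‖ ^ 2 : ℝ) : ℂ) := by
    funext p
    rw [opForm_self_eq hJ hd hT, map_sub, AddSubgroupClass.coe_sub]
  have hlift : (fun n => J (formLift J lam T (s n))) = fun n => (s n : H) :=
    funext fun n => apply_formLift hJ hd hT (s n)
  rw [FormTendsto, hnorm]
  constructor
  · rintro ⟨h1, h2⟩
    have h3 := (cauchySeq_iff_tendsto_norm_sub_sq.1 h1.cauchySeq).const_mul lam
    have h4 : CauchySeq (fun n => formLift J lam T (s n)) := by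
      refine cauchySeq_iff_tendsto_norm_sub_sq.2 ?_
      have h5 := ((Complex.continuous_re.tendsto _).comp h2).add h3
      refine (h5.congr fun p => ?_).trans_eq (by simp)
      rw [Function.comp_apply, Complex.ofReal_re, sub_add_cancel]
    obtain ⟨k, hk⟩ := cauchySeq_tendsto_of_complete h4
    refine ⟨k, tendsto_nhds_unique ?_ h1, hk⟩
    rw [← hlift]
    exact (J.continuous.tendsto k).comp hk
  · rintro ⟨k, rfl, hk⟩
    have h1 : Tendsto (fun n => (s n : H)) atTop (𝓝 (J k)) := by
      rw [← hlift]
      exact (J.continuous.tendsto k).comp hk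
    refine ⟨h1, ?_⟩
    have h2 := (cauchySeq_iff_tendsto_norm_sub_sq.1 hk.cauchySeq).sub
      ((cauchySeq_iff_tendsto_norm_sub_sq.1 h1.cauchySeq).const_mul lam)
    exact ((Complex.continuous_ofReal.tendsto _).comp h2).trans_eq (by simp)

/-- The closed form takes the expected values along sequences that converge in the sense of the
form. -/
lemma tendsto_opForm {s r : ℕ → T.domain} {k l : K}
    (hs : FormTendsto T s (J k)) (hr : FormTendsto T r (J l)) :
    Tendsto (fun n => opForm T (s n) (r n)) atTop (𝓝 (⟪l, k⟫_ℂ - (lam : ℂ) * ⟪J l, J k⟫_ℂ)) := by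
  simp only [opForm_eq hJ hd hT]
  obtain ⟨k', hk', hsk⟩ := (formTendsto_iff hJ hd hT).1 hs
  obtain ⟨l', hl', hrl⟩ := (formTendsto_iff hJ hd hT).1 hr
  rw [hJ hk'] at hsk
  rw [hJ hl'] at hrl
  exact (hrl.inner hsk).sub ((hr.1.inner hs.1).const_mul _)

variable (hT' : DenseRange (formLift J lam T))
include hT'

lemma exists_formTendsto (k : K) : ∃ s, FormTendsto T s (J k) := by
  obtain ⟨x, hx, hxk⟩ := mem_closure_iff_seq_limit.1 (hT' k)
  choose s hs using hx
  exact ⟨s, (formTendsto_iff hJ hd hT).2 ⟨k, rfl, by simpa only [hs] using hxk⟩⟩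

lemma formClosureDomain_eq_range : formClosureDomain T = Set.range J := by
  ext u
  constructor
  · rintro ⟨s, hs⟩
    obtain ⟨k, hk, -⟩ := (formTendsto_iff hJ hd hT).1 hs
    exact ⟨k, hk⟩
  · rintro ⟨k, rfl⟩
    exact exists_formTendsto hJ hd hT hT' k

lemma formClosureValue_iff {k l : K} {c : ℂ} :
    FormClosureValue T (J k) (J l) c ↔ ⟪l, k⟫_ℂ - (lam : ℂ) * ⟪J l, J k⟫_ℂ = c := by
  constructor
  · intro h
    obtain ⟨s, hs⟩ := exists_formTendsto hJ hd hT hT' k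
    obtain ⟨r, hr⟩ := exists_formTendsto hJ hd hT hT' l
    exact tendsto_nhds_unique (tendsto_opForm hJ hd hT hs hr) (h s r hs hr)
  · rintro rfl s r hs hr
    exact tendsto_opForm hJ hd hT hs hr

/-- The closed form is `⟪l, k⟫ - lam ⟪J l, J k⟫`, so its representation condition is the variational
description of the graph with the shift moved to the other side. -/
lemma isFriedrichsExtension_formOperator : IsFriedrichsExtension T (formOperator J lam) where
  le := hT
  isSelfAdjoint := isSelfAdjoint_formOperator hJ hd
  mem_graph_iff u f := by
    rw [mem_graph_formOperator_iff_exists hJ hd, formClosureDomain_eq_range hJ hd hT hT']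
    constructor
    · rintro ⟨k, rfl, h⟩
      refine ⟨⟨k, rfl⟩, ?_⟩
      rintro _ ⟨l, rfl⟩
      rw [formClosureValue_iff hJ hd hT hT', h, inner_add_right, inner_smul_right]
      ring
    · rintro ⟨⟨k, rfl⟩, h⟩
      refine ⟨k, rfl, fun l => ?_⟩
      have := h _ ⟨l, rfl⟩
      rw [formClosureValue_iff hJ hd hT hT'] at this
      rw [inner_add_right, inner_smul_right, ← this]
      ring

omit hJ hd hT hT' [CompleteSpace K] in
lemma IsFriedrichsExtension.unique {T A B : H →ₗ.[ℂ] H} (hA : IsFriedrichsExtension T A)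
    (hB : IsFriedrichsExtension T B) : A = B := by
  refine LinearPMap.eq_of_eq_graph ?_
  ext ⟨u, f⟩
  rw [hA.mem_graph_iff, hB.mem_graph_iff]

end FormOperator

open ComplexConjugate

/-! ### Locally absolutely continuous functions on the half-line -/

lemma ACloc.mul {f g : ℝ → ℂ} (hf : ACloc f) (hg : ACloc g) : ACloc (fun x => f x * g x) :=
  fun a b ha hab => (hf a b ha hab).smul (hg a b ha hab)

lemma ACloc.conj {f : ℝ → ℂ} (hf : ACloc f) : ACloc (fun x => conj (f x)) := by
  intro a b ha hab
  have h := hf a b ha hab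
  rw [absolutelyContinuousOnInterval_iff] at h ⊢
  simpa only [Complex.dist_conj_conj] using h

lemma ACloc.re {f : ℝ → ℂ} (hf : ACloc f) {a b : ℝ} (ha : 0 < a) (hab : a ≤ b) :
    AbsolutelyContinuousOnInterval (fun x => (f x).re) a b := by
  refine ac_of_dist_le (fun x y => ?_) (hf a b ha hab)
  rw [Real.dist_eq, dist_eq_norm, ← Complex.sub_re]
  exact Complex.abs_re_le_norm _

lemma ACloc.im {f : ℝ → ℂ} (hf : ACloc f) {a b : ℝ} (ha : 0 < a) (hab : a ≤ b) :
    AbsolutelyContinuousOnInterval (fun x => (f x).im) a b := by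
  refine ac_of_dist_le (fun x y => ?_) (hf a b ha hab)
  rw [Real.dist_eq, dist_eq_norm, ← Complex.sub_im]
  exact Complex.abs_im_le_norm _

lemma ac_of_re_im {f : ℝ → ℂ} {a b : ℝ}
    (hre : AbsolutelyContinuousOnInterval (fun x => (f x).re) a b)
    (him : AbsolutelyContinuousOnInterval (fun x => (f x).im) a b) :
    AbsolutelyContinuousOnInterval f a b := by
  have hc : ∀ c : ℂ, AbsolutelyContinuousOnInterval (fun _ => c) a b := fun c =>
    (contDiff_const (c := c) (n := 1)).contDiffOn.absolutelyContinuousOnInterval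
  -- The decomposition `f = Re f • 1 + Im f • I` exhibits `f` as a sum of products of absolutely
  -- continuous functions.
  convert! (hre.smul (hc 1)).add (him.smul (hc Complex.I)) using 1
  funext x
  simp [Complex.re_add_im]

lemma acloc_of_contDiffOn {f : ℝ → ℂ} (hf : ContDiffOn ℝ 1 f (Ioi 0)) : ACloc f := by
  intro a b ha hab
  refine (hf.mono ?_).absolutelyContinuousOnInterval
  rw [uIcc_of_le hab]
  exact fun x hx => lt_of_lt_of_le ha hx.1

lemma ae_halfLine_of_forall_Icc {P : ℝ → Prop}
    (h : ∀ a b : ℝ, 0 < a → a ≤ b → ∀ᵐ x : ℝ, x ∈ Icc a b → P x) : ∀ᵐ x ∂halfLine, P x := by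
  have key : ∀ n : ℕ, ∀ᵐ x : ℝ, x ∈ Icc ((1 : ℝ) / (n + 1)) (n + 1) → P x := by
    intro n
    refine h _ _ (by positivity) ?_
    rw [div_le_iff₀ (by positivity)]
    nlinarith [(Nat.cast_nonneg n : (0 : ℝ) ≤ n)]
  rw [← ae_all_iff] at key
  refine (ae_restrict_iff' measurableSet_Ioi).2 ?_
  filter_upwards [key] with x hx hpos
  have hpos : 0 < x := hpos
  obtain ⟨n, hn⟩ := exists_nat_gt (max x (1 / x))
  have h1 : x < n := lt_of_le_of_lt (le_max_left _ _) hn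
  have h2 : 1 / x < n := lt_of_le_of_lt (le_max_right _ _) hn
  rw [div_lt_iff₀ hpos] at h2
  refine hx n ⟨?_, by linarith⟩
  rw [div_le_iff₀ (by positivity)]
  nlinarith

lemma intervalIntegrable_of_locallyIntegrableOn {f : ℝ → ℂ} (hf : LocallyIntegrableOn f (Ioi 0))
    {a b : ℝ} (ha : 0 < a) (hb : 0 < b) : IntervalIntegrable f volume a b := by
  rw [intervalIntegrable_iff']
  refine hf.integrableOn_compact_subset ?_ isCompact_uIcc
  exact fun x hx => lt_of_lt_of_le (lt_min ha hb) hx.1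

lemma ACloc.intervalIntegrable_deriv {f : ℝ → ℂ} (hf : ACloc f) {a b : ℝ} (ha : 0 < a)
    (hab : a ≤ b) : IntervalIntegrable (deriv f) volume a b := by
  have h1 := (hf.re ha hab).intervalIntegrable_deriv
  have h2 := (hf.im ha hab).intervalIntegrable_deriv
  rw [intervalIntegrable_iff_integrableOn_Ioc_of_le hab] at h1 h2 ⊢
  have h3 : IntegrableOn (fun x => ((deriv (fun x => (f x).re) x : ℝ) : ℂ) +
      ((deriv (fun x => (f x).im) x : ℝ) : ℂ) * Complex.I) (Ioc a b) :=
    h1.ofReal.add (h2.ofReal.mul_const _)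
  refine h3.congr ?_
  have hsub : Ioc a b ⊆ Ioi 0 := fun x hx => lt_trans ha hx.1
  filter_upwards [ae_restrict_of_ae_restrict_of_subset hsub hf.ae_differentiableAt] with x hx
  have e1 : deriv (fun x => (f x).re) x = (deriv f x).re :=
    (Complex.reCLM.hasFDerivAt.comp_hasDerivAt x hx.hasDerivAt).deriv
  have e2 : deriv (fun x => (f x).im) x = (deriv f x).im :=
    (Complex.imCLM.hasFDerivAt.comp_hasDerivAt x hx.hasDerivAt).deriv
  rw [e1, e2, Complex.re_add_im]

lemma locallyIntegrableOn_Ioi_of_intervalIntegrable {f : ℝ → ℂ}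
    (h : ∀ a b : ℝ, 0 < a → a ≤ b → IntervalIntegrable f volume a b) :
    LocallyIntegrableOn f (Ioi 0) := by
  rw [locallyIntegrableOn_iff isOpen_Ioi.isLocallyClosed]
  intro k hk hkc
  rcases k.eq_empty_or_nonempty with rfl | hne
  · exact integrableOn_empty
  obtain ⟨a, ha⟩ := hkc.exists_isLeast hne
  obtain ⟨b, hb⟩ := hkc.exists_isGreatest hne
  have hab : a ≤ b := ha.2 hb.1
  have hkab : k ⊆ Icc a b := fun x hx => ⟨ha.2 hx, hb.2 hx⟩
  refine IntegrableOn.mono_set ?_ hkab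
  rw [integrableOn_Icc_iff_integrableOn_Ioc, ← intervalIntegrable_iff_integrableOn_Ioc_of_le hab]
  exact h a b (hk ha.1) hab

lemma ACloc.locallyIntegrableOn_deriv {f : ℝ → ℂ} (hf : ACloc f) :
    LocallyIntegrableOn (deriv f) (Ioi 0) :=
  locallyIntegrableOn_Ioi_of_intervalIntegrable fun _ _ ha hab => hf.intervalIntegrable_deriv ha hab

lemma ac_intervalIntegral {f : ℝ → ℂ} {a b c : ℝ} (h : IntervalIntegrable f volume a b)
    (hc : c ∈ uIcc a b) : AbsolutelyContinuousOnInterval (fun x => ∫ v in c..x, f v) a b := by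
  have h1 : IntervalIntegrable (fun x => (f x).re) volume a b :=
    ⟨h.1.re, h.2.re⟩
  have h2 : IntervalIntegrable (fun x => (f x).im) volume a b :=
    ⟨h.1.im, h.2.im⟩
  have hc' : ∀ x ∈ uIcc a b, IntervalIntegrable f volume c x := fun x hx =>
    h.mono_set (uIcc_subset_uIcc hc hx)
  have e1 := h1.absolutelyContinuousOnInterval_intervalIntegral hc
  have e2 := h2.absolutelyContinuousOnInterval_intervalIntegral hc
  have congr : ∀ g k : ℝ → ℝ, EqOn g k (uIcc a b) → AbsolutelyContinuousOnInterval g a b →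
      AbsolutelyContinuousOnInterval k a b := by
    intro g k hgk hg
    rw [absolutelyContinuousOnInterval_iff] at hg ⊢
    intro ε hε
    obtain ⟨δ, hδ, H⟩ := hg ε hε
    refine ⟨δ, hδ, fun E hE hl => ?_⟩
    convert! H E hE hl using 1
    refine Finset.sum_congr rfl fun i hi => ?_
    rw [hgk (hE.1 i hi).1, hgk (hE.1 i hi).2]
  refine ac_of_re_im (congr _ _ (fun x hx => ?_) e1) (congr _ _ (fun x hx => ?_) e2)
  · exact intervalIntegral.intervalIntegral_re (hc' x hx)
  · exact intervalIntegral.intervalIntegral_im (hc' x hx)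

lemma acloc_intervalIntegral {f : ℝ → ℂ} (hf : LocallyIntegrableOn f (Ioi 0)) :
    ACloc (fun x => ∫ v in (1 : ℝ)..x, f v) := by
  intro a b ha hab
  have h : AbsolutelyContinuousOnInterval (fun x => ∫ v in (1 : ℝ)..x, f v) (min a 1) (max b 1) :=
    ac_intervalIntegral (intervalIntegrable_of_locallyIntegrableOn hf (lt_min ha one_pos)
      (lt_max_of_lt_right one_pos)) (mem_uIcc_of_le (min_le_right _ _) (le_max_right _ _))
  refine h.mono (uIcc_subset_uIcc ?_ ?_)
  · exact mem_uIcc_of_le (min_le_left _ _) (hab.trans (le_max_left _ _))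
  · exact mem_uIcc_of_le ((min_le_left _ _).trans hab) (le_max_left _ _)

lemma ae_hasDerivAt_intervalIntegral {f : ℝ → ℂ} (hf : LocallyIntegrableOn f (Ioi 0)) :
    ∀ᵐ x ∂halfLine, HasDerivAt (fun x => ∫ v in (1 : ℝ)..x, f v) (f x) x := by
  refine ae_halfLine_of_forall_Icc fun a b ha hab => ?_
  have h : IntervalIntegrable f volume (min a 1) (max b 1) :=
    intervalIntegrable_of_locallyIntegrableOn hf (lt_min ha one_pos)
      (lt_max_of_lt_right one_pos)
  filter_upwards [h.ae_hasDerivAt_integral] with x hx hxab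
  refine hx ?_ 1 (mem_uIcc_of_le (min_le_right _ _) (le_max_right _ _))
  exact mem_uIcc_of_le ((min_le_left _ _).trans hxab.1) (hxab.2.trans (le_max_left _ _))

lemma ACloc.integral_deriv_eq_sub {f : ℝ → ℂ} (hf : ACloc f) {a b : ℝ} (ha : 0 < a)
    (hab : a ≤ b) : ∫ x in a..b, deriv f x = f b - f a := by
  have hre : ∫ x in a..b, deriv (fun x => (f x).re) x = (f b - f a).re :=
    (hf.re ha hab).integral_deriv_eq_sub
  have him : ∫ x in a..b, deriv (fun x => (f x).im) x = (f b - f a).im :=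
    (hf.im ha hab).integral_deriv_eq_sub
  have hi := hf.intervalIntegrable_deriv ha hab
  have hd : ∀ᵐ x : ℝ, x ∈ uIoc a b → DifferentiableAt ℝ f x := by
    rw [uIoc_of_le hab, ← ae_restrict_iff' measurableSet_Ioc]
    exact ae_restrict_of_ae_restrict_of_subset (fun x hx => lt_trans ha hx.1)
      hf.ae_differentiableAt
  apply Complex.ext
  · rw [← hre, ← RCLike.re_eq_complex_re, ← intervalIntegral.intervalIntegral_re hi]
    refine intervalIntegral.integral_congr_ae ?_
    filter_upwards [hd] with x hx hxab
    exact (Complex.reCLM.hasFDerivAt.comp_hasDerivAt x (hx hxab).hasDerivAt).deriv.symm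
  · rw [← him, ← RCLike.im_eq_complex_im, ← intervalIntegral.intervalIntegral_im hi]
    refine intervalIntegral.integral_congr_ae ?_
    filter_upwards [hd] with x hx hxab
    exact (Complex.imCLM.hasFDerivAt.comp_hasDerivAt x (hx hxab).hasDerivAt).deriv.symm

/-! ### Compactly supported functions -/

lemma CompactlySupported.mul_left {f : ℝ → ℂ} (hf : CompactlySupported f) (g : ℝ → ℂ) :
    CompactlySupported (fun x => g x * f x) := by
  obtain ⟨a, b, ha, h⟩ := hf
  exact ⟨a, b, ha, fun x hx hn => by simp only [h x hx hn, mul_zero]⟩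

lemma CompactlySupported.mul_right {f : ℝ → ℂ} (hf : CompactlySupported f) (g : ℝ → ℂ) :
    CompactlySupported (fun x => f x * g x) := by
  obtain ⟨a, b, ha, h⟩ := hf
  exact ⟨a, b, ha, fun x hx hn => by simp only [h x hx hn, zero_mul]⟩

lemma CompactlySupported.conj {f : ℝ → ℂ} (hf : CompactlySupported f) :
    CompactlySupported (fun x => conj (f x)) := by
  obtain ⟨a, b, ha, h⟩ := hf
  exact ⟨a, b, ha, fun x hx hn => by simp only [h x hx hn, map_zero]⟩

lemma CompactlySupported.deriv {f : ℝ → ℂ} (hf : CompactlySupported f) :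
    CompactlySupported (deriv f) := by
  obtain ⟨a, b, ha, h⟩ := hf
  refine ⟨a, b, ha, fun x hx hn => ?_⟩
  have : f =ᶠ[𝓝 x] fun _ => 0 := by
    filter_upwards [Ioi_mem_nhds hx, isClosed_Icc.isOpen_compl.mem_nhds hn] with y hy hy'
    exact h y hy hy'
  rw [this.deriv_eq, deriv_const]

lemma integrable_mul_of_compactlySupported {f g : ℝ → ℂ} (hf : LocallyIntegrableOn f (Ioi 0))
    (hg : ContinuousOn g (Ioi 0)) (hc : CompactlySupported g) :
    Integrable (fun x => f x * g x) halfLine := by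
  obtain ⟨a, b, ha, h⟩ := hc
  have hsub : Icc a b ⊆ Ioi 0 := fun x hx => lt_of_lt_of_le ha hx.1
  have h1 : IntegrableOn (fun x => f x * g x) (Icc a b) :=
    (hf.integrableOn_compact_subset hsub isCompact_Icc).mul_continuousOn (hg.mono hsub)
      isCompact_Icc
  exact h1.of_forall_sdiff_eq_zero measurableSet_Ioi fun x hx => by rw [h x hx.1 hx.2, mul_zero]

lemma memLp_of_compactlySupported {g : ℝ → ℂ} (hg : ContinuousOn g (Ioi 0))
    (hc : CompactlySupported g) : MemLp g 2 halfLine := by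
  have hm : AEStronglyMeasurable g halfLine := hg.aestronglyMeasurable measurableSet_Ioi
  rw [memLp_two_iff_integrable_sq_norm hm]
  have := integrable_mul_of_compactlySupported (f := fun x => conj (g x))
    (ContinuousOn.locallyIntegrableOn (Complex.continuous_conj.comp_continuousOn hg)
      measurableSet_Ioi) hg hc
  refine this.norm.congr (Eventually.of_forall fun x => ?_)
  simp [sq]

lemma ACloc.integral_deriv_eq_zero {f : ℝ → ℂ} (hf : ACloc f) (hc : CompactlySupported f) :
    ∫ x, deriv f x ∂halfLine = 0 := by
  obtain ⟨a, b, ha, h⟩ := id hc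
  obtain ⟨a', b', ha', h'⟩ := hc.deriv
  set c := min a a' / 2 with hcdef
  -- The points `c` and `d` lie strictly outside both support intervals. Including `a` in the
  -- maximum ensures `c ≤ d` even if `Icc a b` is empty, that is, `b < a`.
  set d := max (max b b') a + 1 with hd
  have hmin : 0 < min a a' := lt_min ha ha'
  have hc0 : 0 < c := by positivity
  have hca : c < min a a' := by rw [hcdef]; linarith
  have hda : max (max b b') a < d := by rw [hd]; linarith
  have hda' : a < d := lt_of_le_of_lt (le_max_right _ _) hda
  have hdb : max b b' < d := lt_of_le_of_lt (le_max_left _ _) hda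
  have hcd : c ≤ d := (hca.le.trans (min_le_left _ _)).trans hda'.le
  have h1 := hf.integral_deriv_eq_sub hc0 hcd
  have fc : f c = 0 := h c hc0 fun hx => absurd hx.1 (not_le.2 (hca.trans_le (min_le_left _ _)))
  have fd : f d = 0 := h d (hc0.trans_le hcd) fun hx =>
    absurd hx.2 (not_le.2 (lt_of_le_of_lt (le_max_left _ _) hdb))
  rw [fc, fd, sub_zero, intervalIntegral.integral_of_le hcd] at h1
  rw [← h1]
  refine setIntegral_eq_of_subset_of_forall_sdiff_eq_zero measurableSet_Ioi
    (fun x hx => lt_trans hc0 hx.1) fun x hx => h' x hx.1 fun hx' => hx.2 ⟨?_, ?_⟩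
  · exact (hca.trans_le (min_le_right _ _)).trans_le hx'.1
  · exact hx'.2.trans ((le_max_right _ _).trans hdb.le)

/-- Integration by parts without boundary terms. -/
lemma ACloc.integral_mul_deriv {f g : ℝ → ℂ} (hf : ACloc f) (hg : ACloc g)
    (hc : CompactlySupported g) :
    ∫ x, f x * deriv g x ∂halfLine = -∫ x, deriv f x * g x ∂halfLine := by
  have h1 := (hf.mul hg).integral_deriv_eq_zero (hc.mul_left f)
  have i1 : Integrable (fun x => deriv f x * g x) halfLine :=
    integrable_mul_of_compactlySupported hf.locallyIntegrableOn_deriv hg.continuousOn hc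
  have hint : Integrable (fun x => f x * deriv g x) halfLine := by
    obtain ⟨a, b, ha, h⟩ := hc.deriv
    have hsub : Icc a b ⊆ Ioi 0 := fun x hx => lt_of_lt_of_le ha hx.1
    have h1 : IntegrableOn (fun x => f x * deriv g x) (Icc a b) :=
      (hg.locallyIntegrableOn_deriv.integrableOn_compact_subset hsub
        isCompact_Icc).continuousOn_mul (hf.continuousOn.mono hsub) isCompact_Icc
    exact h1.of_forall_sdiff_eq_zero measurableSet_Ioi fun x hx => by rw [h x hx.1 hx.2, mul_zero]
  rw [← sub_eq_zero, sub_neg_eq_add, ← integral_add hint i1, ← h1]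
  refine integral_congr_ae ?_
  filter_upwards [hf.ae_differentiableAt, hg.ae_differentiableAt] with x h2 h3
  refine Eq.trans ?_ (h2.hasDerivAt.mul h3.hasDerivAt).deriv.symm
  ring

/-! ### Test functions and weak derivatives -/

/-- `φ` is a real test function on `(0, ∞)`. -/
structure IsTest (φ : ℝ → ℝ) : Prop where
  smooth : ContDiff ℝ ∞ φ
  compact : HasCompactSupport φ
  subset : tsupport φ ⊆ Ioi 0

lemma exists_tsupport_subset_Icc {E : Type*} [Zero E] {φ : ℝ → E} (hc : HasCompactSupport φ)
    (hs : tsupport φ ⊆ Ioi 0) : ∃ a b : ℝ, 0 < a ∧ tsupport φ ⊆ Icc a b := by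
  rcases (tsupport φ).eq_empty_or_nonempty with h | hne
  · exact ⟨1, 1, one_pos, by simp [h]⟩
  obtain ⟨a, ha⟩ := hc.isCompact.exists_isLeast hne
  obtain ⟨b, hb⟩ := hc.isCompact.exists_isGreatest hne
  exact ⟨a, b, hs ha.1, fun x hx => ⟨ha.2 hx, hb.2 hx⟩⟩

lemma compactlySupported_of_tsupport {φ : ℝ → ℂ} (hc : HasCompactSupport φ)
    (hs : tsupport φ ⊆ Ioi 0) : CompactlySupported φ := by
  obtain ⟨a, b, ha, h⟩ := exists_tsupport_subset_Icc hc hs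
  exact ⟨a, b, ha, fun x _ hn => image_eq_zero_of_notMem_tsupport fun hx => hn (h hx)⟩

namespace IsTest

variable {φ ψ : ℝ → ℝ}

lemma add (hφ : IsTest φ) (hψ : IsTest ψ) : IsTest (fun x => φ x + ψ x) :=
  ⟨hφ.smooth.add hψ.smooth, hφ.compact.add hψ.compact,
    (tsupport_add φ ψ).trans (union_subset hφ.subset hψ.subset)⟩

lemma const_mul (hφ : IsTest φ) (c : ℝ) : IsTest (fun x => c * φ x) := by
  have hsub : tsupport (fun x => c * φ x) ⊆ tsupport φ :=
    closure_mono fun x hx hx' => hx (by simp [hx'])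
  exact ⟨contDiff_const.mul hφ.smooth, hφ.compact.mul_left, hsub.trans hφ.subset⟩

lemma integrable (hφ : IsTest φ) : Integrable φ :=
  hφ.smooth.continuous.integrable_of_hasCompactSupport hφ.compact

lemma setIntegral_Ioi {E : Type*} [NormedAddCommGroup E] [NormedSpace ℝ E] (hφ : IsTest φ)
    (f : ℝ → E) : ∫ x, φ x • f x ∂halfLine = ∫ x, φ x • f x :=
  setIntegral_eq_integral_of_forall_compl_eq_zero fun x hx => by
    rw [image_eq_zero_of_notMem_tsupport fun h => hx (hφ.subset h), zero_smul]

lemma ofReal_smooth (hφ : IsTest φ) : ContDiff ℝ ∞ (fun x => (φ x : ℂ)) :=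
  Complex.ofRealCLM.contDiff.comp hφ.smooth

lemma tsupport_ofReal (φ : ℝ → ℝ) : tsupport (fun x => (φ x : ℂ)) = tsupport φ := by
  rw [tsupport, tsupport]
  congr 1
  ext x
  simp

lemma ofReal_compact (hφ : IsTest φ) : HasCompactSupport (fun x => (φ x : ℂ)) := by
  rw [HasCompactSupport, tsupport_ofReal]
  exact hφ.compact

lemma ofReal_subset (hφ : IsTest φ) : tsupport (fun x => (φ x : ℂ)) ⊆ Ioi 0 := by
  rw [tsupport_ofReal]
  exact hφ.subset

lemma compactlySupported (hφ : IsTest φ) : CompactlySupported (fun x => (φ x : ℂ)) :=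
  compactlySupported_of_tsupport hφ.ofReal_compact hφ.ofReal_subset

lemma acloc (hφ : IsTest φ) : ACloc (fun x => (φ x : ℂ)) :=
  acloc_of_contDiffOn (hφ.ofReal_smooth.of_le (by simp)).contDiffOn

lemma deriv_ofReal (hφ : IsTest φ) :
    deriv (fun x => (φ x : ℂ)) = fun x => ((deriv φ x : ℝ) : ℂ) := by
  funext x
  exact ((hφ.smooth.differentiable (by simp)) x).hasDerivAt.ofReal_comp.deriv

lemma deriv (hφ : IsTest φ) : IsTest (deriv φ) :=
  ⟨(contDiff_infty_iff_deriv.1 hφ.smooth).2, hφ.compact.deriv,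
    (closure_minimal support_deriv_subset (isClosed_tsupport φ)).trans hφ.subset⟩

/-- A test function with vanishing integral is the derivative of a test function. -/
lemma exists_primitive (hψ : IsTest ψ) (h0 : ∫ x, ψ x = 0) :
    ∃ φ, IsTest φ ∧ _root_.deriv φ = ψ := by
  obtain ⟨a, b, ha, hab⟩ := exists_tsupport_subset_Icc hψ.compact hψ.subset
  have hcont := hψ.smooth.continuous
  have hd : _root_.deriv (fun x => ∫ t in (0 : ℝ)..x, ψ t) = ψ :=
    funext fun x => hcont.deriv_integral ψ 0 x
  have hdiff : Differentiable ℝ (fun x => ∫ t in (0 : ℝ)..x, ψ t) := fun x =>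
    (hcont.integral_hasStrictDerivAt 0 x).hasDerivAt.differentiableAt
  have hz : ∀ t, t ∉ Icc a b → ψ t = 0 := fun t ht =>
    image_eq_zero_of_notMem_tsupport fun h => ht (hab h)
  have hsub : tsupport (fun x => ∫ t in (0 : ℝ)..x, ψ t) ⊆ Icc a b := by
    refine closure_minimal (fun x hx => ?_) isClosed_Icc
    by_contra hn
    apply hx
    rcases lt_or_ge x a with hxa | hxa
    · refine (intervalIntegral.integral_congr (g := fun _ => 0) fun t ht => ?_).trans (by simp)
      refine hz t fun ht' => ?_
      have h1 : t ≤ max 0 x := ht.2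
      exact absurd (ht'.1.trans h1) (not_le.2 (max_lt ha hxa))
    -- To the right of the support the primitive equals the full integral of `ψ`, which vanishes by
    -- `h0`.
    · have hxb : b < x := lt_of_not_ge fun h => hn ⟨hxa, h⟩
      refine Eq.trans ?_ h0
      refine intervalIntegral.integral_eq_integral_of_support_subset fun t ht => ?_
      have := hab (subset_tsupport _ ht)
      exact ⟨lt_of_lt_of_le ha this.1, this.2.trans hxb.le⟩
  refine ⟨_, ⟨contDiff_infty_iff_deriv.2 ⟨hdiff, by rw [hd]; exact hψ.smooth⟩,
    HasCompactSupport.of_support_subset_isCompact isCompact_Icc (subset_closure.trans hsub),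
    hsub.trans fun x hx => lt_of_lt_of_le ha hx.1⟩, hd⟩

lemma exists_integral_eq_one : ∃ ρ, IsTest ρ ∧ ∫ x, ρ x = 1 := by
  let b : ContDiffBump (2 : ℝ) := ⟨1 / 2, 1, by norm_num, by norm_num⟩
  refine ⟨b.normed volume, ⟨b.contDiff_normed, b.hasCompactSupport_normed, ?_⟩, b.integral_normed⟩
  rw [b.tsupport_normed_eq, Real.closedBall_eq_Icc]
  intro x hx
  have h1 : (2 : ℝ) - 1 ≤ x := hx.1
  exact lt_of_lt_of_le (by norm_num) h1

end IsTest

lemma continuousOn_locallyIntegrableOn {f : ℝ → ℂ} (hf : ContinuousOn f (Ioi 0)) :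
    LocallyIntegrableOn f (Ioi 0) := hf.locallyIntegrableOn measurableSet_Ioi

lemma integrable_test_mul {f : ℝ → ℂ} (hf : LocallyIntegrableOn f (Ioi 0)) {φ : ℝ → ℝ}
    (hφ : IsTest φ) : Integrable (fun x => (φ x : ℂ) * f x) halfLine := by
  simpa only [mul_comm] using integrable_mul_of_compactlySupported hf
    hφ.ofReal_smooth.continuous.continuousOn hφ.compactlySupported

lemma ae_eq_zero_of_integral_test {f : ℝ → ℂ} (hf : LocallyIntegrableOn f (Ioi 0))
    (h : ∀ φ, IsTest φ → ∫ x, (φ x : ℂ) * f x ∂halfLine = 0) : f =ᵐ[halfLine] 0 := by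
  refine (ae_restrict_iff' measurableSet_Ioi).2 ?_
  refine isOpen_Ioi.ae_eq_zero_of_integral_contDiff_smul_eq_zero hf fun φ h1 h2 h3 => ?_
  rw [← IsTest.setIntegral_Ioi ⟨h1, h2, h3⟩, ← h φ ⟨h1, h2, h3⟩]
  simp only [Complex.real_smul]

/-- A function with vanishing weak derivative is constant. -/
lemma ae_eq_const_of_weakDeriv_eq_zero {f : ℝ → ℂ} (hf : LocallyIntegrableOn f (Ioi 0))
    (h : ∀ φ, IsTest φ → ∫ x, ((deriv φ x : ℝ) : ℂ) * f x ∂halfLine = 0) :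
    ∃ c, f =ᵐ[halfLine] fun _ => c := by
  obtain ⟨ρ, hρ, hρ1⟩ := IsTest.exists_integral_eq_one
  set c := ∫ x, (ρ x : ℂ) * f x ∂halfLine with hc
  have hcl : LocallyIntegrableOn (fun _ : ℝ => c) (Ioi 0) :=
    continuousOn_locallyIntegrableOn continuousOn_const
  refine ⟨c, ?_⟩
  have key : (fun x => f x - c) =ᵐ[halfLine] 0 := by
    refine ae_eq_zero_of_integral_test (hf.sub hcl) fun ψ hψ => ?_
    -- Subtracting `(∫ ψ) ρ` makes the integral vanish, so the difference is the derivative of a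
    -- test function and the hypothesis applies to it. This also explains the choice of `c` as the
    -- pairing of `f` with `ρ`.
    have h0 : ∫ x, (ψ x + (-∫ y, ψ y) * ρ x) = 0 := by
      rw [integral_add hψ.integrable (hρ.integrable.const_mul _), integral_const_mul, hρ1]
      ring
    obtain ⟨φ, hφ, hφd⟩ := (hψ.add (hρ.const_mul (-∫ y, ψ y))).exists_primitive h0
    have h1 := h φ hφ
    rw [hφd] at h1
    have i1 := integrable_test_mul hf hψ
    have i2 := integrable_test_mul hf hρ
    have e1 : ∀ x, ((ψ x + (-∫ y, ψ y) * ρ x : ℝ) : ℂ) * f x =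
        (ψ x : ℂ) * f x - ((∫ y, ψ y : ℝ) : ℂ) * ((ρ x : ℂ) * f x) := by
      intro x
      push_cast
      ring
    simp only [e1] at h1
    rw [integral_sub i1 (i2.const_mul _), integral_const_mul, ← hc] at h1
    have e2 : ∫ x, (ψ x : ℂ) * c ∂halfLine = ((∫ y, ψ y : ℝ) : ℂ) * c := by
      have e3 := hψ.setIntegral_Ioi (fun _ => (1 : ℝ))
      simp only [smul_eq_mul, mul_one] at e3
      rw [integral_mul_const, integral_complex_ofReal, e3]
    simp only [mul_sub]
    rw [integral_sub i1 (integrable_test_mul hcl hψ), e2, h1]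
  filter_upwards [key] with x hx
  exact sub_eq_zero.1 hx

/-- A locally integrable function with a locally integrable weak derivative is locally absolutely
continuous. -/
lemma exists_ae_eq_primitive_of_weakDeriv {f g : ℝ → ℂ} (hf : LocallyIntegrableOn f (Ioi 0))
    (hg : LocallyIntegrableOn g (Ioi 0))
    (h : ∀ φ, IsTest φ → ∫ x, ((deriv φ x : ℝ) : ℂ) * f x ∂halfLine =
      -∫ x, (φ x : ℂ) * g x ∂halfLine) :
    ∃ c, f =ᵐ[halfLine] fun x => c + ∫ t in (1 : ℝ)..x, g t := by
  have hG := acloc_intervalIntegral hg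
  have hGl := continuousOn_locallyIntegrableOn hG.continuousOn
  obtain ⟨c, hc⟩ := ae_eq_const_of_weakDeriv_eq_zero (hf.sub hGl) fun φ hφ => by
    have h1 := hG.integral_mul_deriv hφ.acloc hφ.compactlySupported
    have h2 : ∫ x, deriv (fun x => ∫ t in (1 : ℝ)..x, g t) x * (φ x : ℂ) ∂halfLine =
        ∫ x, (φ x : ℂ) * g x ∂halfLine := by
      refine integral_congr_ae ?_
      filter_upwards [ae_hasDerivAt_intervalIntegral hg] with x hx
      rw [hx.deriv, mul_comm]
    rw [h2, hφ.deriv_ofReal, ← h φ hφ] at h1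
    simp only [Pi.sub_apply, mul_sub]
    rw [integral_sub (integrable_test_mul hf hφ.deriv) (integrable_test_mul hGl hφ.deriv), ← h1,
      sub_eq_zero]
    simp only [mul_comm]
  refine ⟨c, ?_⟩
  filter_upwards [hc] with x hx
  rw [← hx, Pi.sub_apply, sub_add_cancel]

lemma acloc_const_add_primitive {g : ℝ → ℂ} (hg : LocallyIntegrableOn g (Ioi 0)) (c : ℂ) :
    ACloc (fun x => c + ∫ t in (1 : ℝ)..x, g t) :=
  (acloc_of_contDiffOn contDiffOn_const).add (acloc_intervalIntegral hg)

lemma ae_deriv_const_add_primitive {g : ℝ → ℂ} (hg : LocallyIntegrableOn g (Ioi 0)) (c : ℂ) :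
    deriv (fun x => c + ∫ t in (1 : ℝ)..x, g t) =ᵐ[halfLine] g := by
  filter_upwards [ae_hasDerivAt_intervalIntegral hg] with x hx
  exact (hx.const_add c).deriv

lemma hasDerivAt_const_add_primitive {g : ℝ → ℂ} (hg : ContinuousOn g (Ioi 0)) (c : ℂ) {x : ℝ}
    (hx : 0 < x) : HasDerivAt (fun x => c + ∫ t in (1 : ℝ)..x, g t) (g x) x := by
  refine HasDerivAt.const_add c (intervalIntegral.integral_hasDerivAt_right
    (intervalIntegrable_of_locallyIntegrableOn (continuousOn_locallyIntegrableOn hg) one_pos hx)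
    ?_ (hg.continuousAt (Ioi_mem_nhds hx)))
  exact hg.stronglyMeasurableAtFilter isOpen_Ioi x hx

/-! ### The space `H¹₀(0, ∞)` -/

lemma L2.inner_eq_integral {u v : L2} {f g : ℝ → ℂ} (hu : u =ᵐ[halfLine] f)
    (hv : v =ᵐ[halfLine] g) : ⟪u, v⟫_ℂ = ∫ x, conj (f x) * g x ∂halfLine := by
  rw [MeasureTheory.L2.inner_def]
  refine integral_congr_ae ?_
  filter_upwards [hu, hv] with x h1 h2
  rw [h1, h2, RCLike.inner_apply, mul_comm]

lemma L2.integrable_conj_mul {u v : L2} {f g : ℝ → ℂ} (hu : u =ᵐ[halfLine] f)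
    (hv : v =ᵐ[halfLine] g) : Integrable (fun x => conj (f x) * g x) halfLine := by
  refine (MeasureTheory.L2.integrable_inner (𝕜 := ℂ) u v).congr ?_
  filter_upwards [hu, hv] with x h1 h2
  rw [h1, h2, RCLike.inner_apply, mul_comm]

lemma L2.norm_sq_eq_integral (u : L2) : ‖u‖ ^ 2 = ∫ x, ‖u x‖ ^ 2 ∂halfLine := by
  have h := L2.inner_eq_integral (EventuallyEq.refl _ u) (EventuallyEq.refl _ u)
  have e : ∀ x, conj (u x) * u x = ((‖u x‖ ^ 2 : ℝ) : ℂ) := fun x => by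
    rw [Complex.conj_mul']
    norm_cast
  simp only [e] at h
  rw [inner_self_eq_norm_sq_to_K, integral_complex_ofReal] at h
  rw [← Complex.ofReal_inj, ← h]
  push_cast
  rfl

lemma L2.locallyIntegrableOn (u : L2) : LocallyIntegrableOn u (Ioi 0) :=
  locallyIntegrableOn_of_locallyIntegrable_restrict
    ((Lp.memLp u).locallyIntegrable (by norm_num))

/-- The pairs `(φ, φ')` form a subspace. -/
def testSubmodule : Submodule ℂ (L2 × L2) where
  carrier := testPairs
  zero_mem' := by
    refine ⟨0, contDiff_const, HasCompactSupport.zero, by simp, Lp.coeFn_zero _ _ _, ?_⟩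
    have : deriv (0 : ℝ → ℂ) = 0 := funext fun y => deriv_const y (0 : ℂ)
    rw [this]
    exact Lp.coeFn_zero _ _ _
  add_mem' := by
    rintro ⟨u, w⟩ ⟨u', w'⟩ ⟨f, hf, hfc, hfs, h1, h2⟩ ⟨g, hg, hgc, hgs, h1', h2'⟩
    refine ⟨f + g, hf.add hg, hfc.add hgc, (tsupport_add f g).trans (union_subset hfs hgs),
      (Lp.coeFn_add u u').trans (h1.add h1'), ?_⟩
    have : deriv (f + g) = deriv f + deriv g := funext fun x =>
      _root_.deriv_add (hf.differentiable (by simp) x) (hg.differentiable (by simp) x)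
    rw [this]
    exact (Lp.coeFn_add w w').trans (h2.add h2')
  smul_mem' := by
    rintro c ⟨u, w⟩ ⟨f, hf, hfc, hfs, h1, h2⟩
    refine ⟨c • f, hf.const_smul c, hfc.smul_left, ?_, (Lp.coeFn_smul c u).trans (h1.const_smul c),
      ?_⟩
    · have hsub : tsupport (c • f) ⊆ tsupport f :=
        closure_mono fun x hx hx' => hx (by simp [hx'])
      exact hsub.trans hfs
    · rw [deriv_const_smul']
      exact (Lp.coeFn_smul c w).trans (h2.const_smul c)

/-- `H¹₀(0, ∞)`, as the space of the pairs `(u, u')`. -/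
def h10Submodule : Submodule ℂ (L2 × L2) := testSubmodule.topologicalClosure

lemma isClosed_h10Submodule : IsClosed (h10Submodule : Set (L2 × L2)) :=
  testSubmodule.isClosed_topologicalClosure

lemma memLp_test {φ : ℝ → ℝ} (hφ : IsTest φ) : MemLp (fun x => (φ x : ℂ)) 2 halfLine :=
  memLp_of_compactlySupported hφ.ofReal_smooth.continuous.continuousOn hφ.compactlySupported

/-- Both sides are inner products with fixed elements of `L²`, so the identity is a closed condition
on the pair. It suffices to check it on `testPairs`, where it is integration by parts. -/
lemma IsH10.integral_deriv_mul {u u' : L2} (h : IsH10 u u') {φ : ℝ → ℝ} (hφ : IsTest φ) :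
    ∫ x, ((deriv φ x : ℝ) : ℂ) * u x ∂halfLine = -∫ x, (φ x : ℂ) * u' x ∂halfLine := by
  have e1 : ∀ v : L2, ∫ x, ((deriv φ x : ℝ) : ℂ) * v x ∂halfLine =
      ⟪(memLp_test hφ.deriv).toLp _, v⟫_ℂ := fun v => by
    rw [L2.inner_eq_integral (MemLp.coeFn_toLp _) (EventuallyEq.refl _ _)]
    simp only [Complex.conj_ofReal]
  have e2 : ∀ v : L2, ∫ x, (φ x : ℂ) * v x ∂halfLine =
      ⟪(memLp_test hφ).toLp _, v⟫_ℂ := fun v => by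
    rw [L2.inner_eq_integral (MemLp.coeFn_toLp _) (EventuallyEq.refl _ _)]
    simp only [Complex.conj_ofReal]
  have hcl : IsClosed {p : L2 × L2 | ⟪(memLp_test hφ.deriv).toLp _, p.1⟫_ℂ =
      -⟪(memLp_test hφ).toLp _, p.2⟫_ℂ} :=
    isClosed_eq (by fun_prop) (by fun_prop)
  rw [e1, e2]
  refine closure_minimal ?_ hcl h
  rintro ⟨v, v'⟩ ⟨ψ, hψ, hψc, hψs, h1, h2⟩
  have hac : ACloc ψ := acloc_of_contDiffOn (hψ.of_le (by simp)).contDiffOn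
  have := hac.integral_mul_deriv hφ.acloc hφ.compactlySupported
  change ⟪_, v⟫_ℂ = -⟪_, v'⟫_ℂ
  rw [← e1, ← e2]
  have h1 : v =ᵐ[halfLine] ψ := h1
  have h2 : v' =ᵐ[halfLine] deriv ψ := h2
  rw [hφ.deriv_ofReal] at this
  calc ∫ x, ((deriv φ x : ℝ) : ℂ) * v x ∂halfLine
      = ∫ x, ψ x * ((deriv φ x : ℝ) : ℂ) ∂halfLine :=
        integral_congr_ae (h1.mono fun x hx => by simp only [hx, mul_comm])
    _ = -∫ x, deriv ψ x * (φ x : ℂ) ∂halfLine := this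
    _ = -∫ x, (φ x : ℂ) * v' x ∂halfLine := by
        rw [neg_inj]
        exact integral_congr_ae (h2.mono fun x hx => by simp only [hx, mul_comm])

lemma exists_acloc_of_weakDeriv {f g : ℝ → ℂ} (hf : LocallyIntegrableOn f (Ioi 0))
    (hg : LocallyIntegrableOn g (Ioi 0))
    (h : ∀ φ, IsTest φ → ∫ x, ((deriv φ x : ℝ) : ℂ) * f x ∂halfLine =
      -∫ x, (φ x : ℂ) * g x ∂halfLine) :
    ∃ F, ACloc F ∧ f =ᵐ[halfLine] F ∧ g =ᵐ[halfLine] deriv F := by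
  obtain ⟨c, hc⟩ := exists_ae_eq_primitive_of_weakDeriv hf hg h
  exact ⟨_, acloc_const_add_primitive hg c, hc, (ae_deriv_const_add_primitive hg c).symm⟩

lemma IsH10.exists_acloc {u u' : L2} (h : IsH10 u u') :
    ∃ f, ACloc f ∧ u =ᵐ[halfLine] f ∧ u' =ᵐ[halfLine] deriv f :=
  exists_acloc_of_weakDeriv (L2.locallyIntegrableOn u) (L2.locallyIntegrableOn u')
    fun _ hφ => h.integral_deriv_mul hφ

lemma ACloc.eqOn_of_ae_eq {f g : ℝ → ℂ} (hf : ACloc f) (hg : ACloc g)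
    (h : f =ᵐ[halfLine] g) : EqOn f g (Ioi 0) :=
  Measure.eqOn_open_of_ae_eq h isOpen_Ioi hf.continuousOn hg.continuousOn

/-- In particular `u'` is determined by `u`: two locally absolutely continuous representatives
coincide on `(0, ∞)`. -/
lemma IsH10.deriv_ae_eq {u u' : L2} (h : IsH10 u u') {f : ℝ → ℂ} (hf : ACloc f)
    (hu : u =ᵐ[halfLine] f) : u' =ᵐ[halfLine] deriv f := by
  obtain ⟨g, hg, h1, h2⟩ := h.exists_acloc
  have e := deriv_eqOn_nhds (hg.eqOn_of_ae_eq hf (h1.symm.trans hu))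
  filter_upwards [h2, ae_restrict_mem measurableSet_Ioi] with x hx hpos
  rw [hx, e hpos]

/-- A compactly supported absolutely continuous function with square integrable derivative belongs
to `H¹₀(0, ∞)`. -/
lemma isH10_of_acloc {f : ℝ → ℂ} (hf : ACloc f) (hc : CompactlySupported f) {u u' : L2}
    (hu : u =ᵐ[halfLine] f) (hu' : u' =ᵐ[halfLine] deriv f) : IsH10 u u' := by
  let e := (WithLp.linearEquiv 2 ℂ (L2 × L2)).symm
  let S : Submodule ℂ (WithLp 2 (L2 × L2)) := testSubmodule.map (e : _ →ₗ[ℂ] _)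
  have hmem : WithLp.toLp 2 (u, u') ∈ S.topologicalClosure := by
    -- The closure is a double orthogonal complement. If `w` is orthogonal to all pairs `(φ, φ')`,
    -- then `w.fst` is the weak derivative of `w.snd`. Hence `w = (F', F)` with `F` locally
    -- absolutely continuous, and integration by parts against `f` shows that `w` is orthogonal to
    -- `(u, u')`.
    rw [← Submodule.orthogonal_orthogonal_eq_closure, Submodule.mem_orthogonal]
    rintro w hw
    have hw' : ∀ φ, IsTest φ → ∫ x, ((deriv φ x : ℝ) : ℂ) * w.snd x ∂halfLine =
        -∫ x, (φ x : ℂ) * w.fst x ∂halfLine := by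
      intro φ hφ
      have hp : ((memLp_test hφ).toLp _, (memLp_test hφ.deriv).toLp _) ∈ testSubmodule := by
        refine ⟨_, hφ.ofReal_smooth, hφ.ofReal_compact, hφ.ofReal_subset,
          (memLp_test hφ).coeFn_toLp, ?_⟩
        rw [hφ.deriv_ofReal]
        exact (memLp_test hφ.deriv).coeFn_toLp
      have h1 := (Submodule.mem_orthogonal _ _).1 hw _ (Submodule.mem_map_of_mem hp)
      have h2 : ⟪(memLp_test hφ).toLp _, w.fst⟫_ℂ + ⟪(memLp_test hφ.deriv).toLp _, w.snd⟫_ℂ = 0 :=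
        h1
      rw [L2.inner_eq_integral (memLp_test hφ).coeFn_toLp (EventuallyEq.refl _ _),
        L2.inner_eq_integral (memLp_test hφ.deriv).coeFn_toLp (EventuallyEq.refl _ _),
        add_comm] at h2
      simpa only [Complex.conj_ofReal] using eq_neg_of_add_eq_zero_left h2
    obtain ⟨F, hF, h1, h2⟩ := exists_acloc_of_weakDeriv (L2.locallyIntegrableOn _)
      (L2.locallyIntegrableOn _) hw'
    have h3 := hF.conj.integral_mul_deriv hf hc
    have h4 : ⟪w.fst, u⟫_ℂ + ⟪w.snd, u'⟫_ℂ = 0 := by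
      rw [L2.inner_eq_integral h2 hu, L2.inner_eq_integral h1 hu', h3, ← sub_eq_add_neg,
        sub_eq_zero]
      refine integral_congr_ae ?_
      filter_upwards [hF.ae_differentiableAt] with x hx
      have := hx.hasDerivAt.star.deriv
      exact congrArg (· * f x) this.symm
    exact h4
  have h5 := image_closure_subset_closure_image (WithLp.prod_continuous_ofLp 2 L2 L2)
    (mem_image_of_mem _ hmem)
  refine closure_mono ?_ h5
  rintro _ ⟨_, ⟨p, hp, rfl⟩, rfl⟩
  exact hp

/-! ### Multiplication operators -/

/-- Along a common subsequence both components converge almost everywhere, and the relation passes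
to the pointwise limit. No measurability or boundedness of `m` enters. -/
lemma isClosed_ae_eq_mul (m : ℝ → ℝ) :
    IsClosed {p : L2 × L2 | p.2 =ᵐ[halfLine] fun x => (m x : ℂ) * p.1 x} := by
  refine isClosed_of_closure_subset fun p hp => ?_
  obtain ⟨s, hs, hlim⟩ := mem_closure_iff_seq_limit.1 hp
  have h1 : Tendsto (fun n => (s n).1) atTop (𝓝 p.1) := (continuous_fst.tendsto _).comp hlim
  have h2 : Tendsto (fun n => (s n).2) atTop (𝓝 p.2) := (continuous_snd.tendsto _).comp hlim
  obtain ⟨ns, hns, h3⟩ := (tendstoInMeasure_of_tendsto_Lp h1).exists_seq_tendsto_ae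
  obtain ⟨ms, hms, h4⟩ := (tendstoInMeasure_of_tendsto_Lp
    (h2.comp hns.tendsto_atTop)).exists_seq_tendsto_ae
  have h5 : ∀ᵐ x ∂halfLine, ∀ n, (s n).2 x = (m x : ℂ) * (s n).1 x := ae_all_iff.2 hs
  filter_upwards [h3, h4, h5] with x h3 h4 h5
  refine tendsto_nhds_unique h4 ?_
  simp only [Function.comp_apply, h5]
  exact (h3.comp hms.tendsto_atTop).const_mul _

/-! ### Hardy's inequality -/

/-- Polarized Hardy identity: `(f' , g/x) + (f/x, g') = (f/x, g/x)` if `g` has compact support. -/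
lemma inner_deriv_add_inner_deriv {f g : ℝ → ℂ} (hf : ACloc f) (hg : ACloc g)
    (hc : CompactlySupported g) {u' h v' k : L2} (hu' : u' =ᵐ[halfLine] deriv f)
    (hh : h =ᵐ[halfLine] fun x => ((x⁻¹ : ℝ) : ℂ) * f x) (hv' : v' =ᵐ[halfLine] deriv g)
    (hk : k =ᵐ[halfLine] fun x => ((x⁻¹ : ℝ) : ℂ) * g x) :
    ⟪u', k⟫_ℂ + ⟪h, v'⟫_ℂ = ⟪h, k⟫_ℂ := by
  have hinv : ∀ x : ℝ, 0 < x → HasDerivAt (fun x : ℝ => ((x⁻¹ : ℝ) : ℂ))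
      ((-(x ^ 2)⁻¹ : ℝ) : ℂ) x := fun x hx => (hasDerivAt_inv hx.ne').ofReal_comp
  have hinvac : ACloc (fun x : ℝ => ((x⁻¹ : ℝ) : ℂ)) := by
    refine acloc_of_contDiffOn (Complex.ofRealCLM.contDiff.comp_contDiffOn ?_)
    exact contDiffOn_id.inv fun x hx => (ne_of_gt hx)
  -- The integral of the derivative of `conj f · g / x` vanishes. The derivative of `1/x`
  -- contributes `-conj f · g / x²`, the right-hand side of the identity.
  have h1 := (hf.conj.mul (hinvac.mul hg)).integral_deriv_eq_zero
    ((hc.mul_left _).mul_left _)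
  have i1 := L2.integrable_conj_mul hu' hk
  have i2 := L2.integrable_conj_mul hh hv'
  have i3 := L2.integrable_conj_mul hh hk
  have i12 : Integrable (fun x => conj (deriv f x) * (((x⁻¹ : ℝ) : ℂ) * g x) +
      conj (((x⁻¹ : ℝ) : ℂ) * f x) * deriv g x) halfLine := i1.add i2
  rw [← sub_eq_zero, L2.inner_eq_integral hu' hk, L2.inner_eq_integral hh hv',
    L2.inner_eq_integral hh hk, ← integral_add i1 i2, ← integral_sub i12 i3, ← h1]
  refine integral_congr_ae ?_
  filter_upwards [hf.ae_differentiableAt, hg.ae_differentiableAt,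
    ae_restrict_mem measurableSet_Ioi] with x hfx hgx hx
  have hx : 0 < x := hx
  refine Eq.trans ?_ (hfx.hasDerivAt.star.mul ((hinv x hx).mul hgx.hasDerivAt)).deriv.symm
  simp only [map_mul, Complex.conj_ofReal, Complex.star_def, Pi.mul_apply]
  have hxc : (x : ℂ) ≠ 0 := by exact_mod_cast hx.ne'
  push_cast
  field_simp
  ring

/-- Hardy's inequality, together with the underlying identity. -/
lemma IsH10.exists_hardy {u u' : L2} (hu : IsH10 u u') :
    ∃ h : L2, h =ᵐ[halfLine] (fun x => ((x⁻¹ : ℝ) : ℂ) * u x) ∧ ‖h‖ ≤ 2 * ‖u'‖ ∧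
      ⟪u', h⟫_ℂ + ⟪h, u'⟫_ℂ = ⟪h, h⟫_ℂ := by
  -- Cauchy–Schwarz turns the identity into `‖k‖² ≤ 2 ‖v'‖ ‖k‖`. Applied to differences of test
  -- functions, it makes the sequence of the quotients by `x` Cauchy.
  have bound : ∀ v' k : L2, ⟪v', k⟫_ℂ + ⟪k, v'⟫_ℂ = ⟪k, k⟫_ℂ → ‖k‖ ≤ 2 * ‖v'‖ := by
    intro v' k h
    have h1 : ‖k‖ ^ 2 ≤ 2 * ‖v'‖ * ‖k‖ := by
      have h2 : ((‖k‖ ^ 2 : ℝ) : ℂ) = ⟪k, k⟫_ℂ := by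
        rw [inner_self_eq_norm_sq_to_K]
        norm_cast
      calc ‖k‖ ^ 2 = ‖((‖k‖ ^ 2 : ℝ) : ℂ)‖ := by simp
        _ = ‖⟪v', k⟫_ℂ + ⟪k, v'⟫_ℂ‖ := by rw [h2, h]
        _ ≤ ‖v'‖ * ‖k‖ + ‖k‖ * ‖v'‖ :=
          (norm_add_le _ _).trans (add_le_add (norm_inner_le_norm _ _) (norm_inner_le_norm _ _))
        _ = 2 * ‖v'‖ * ‖k‖ := by ring
    rcases (norm_nonneg k).eq_or_lt with h0 | h0
    · rw [← h0]
      positivity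
    · nlinarith
  have hardyTest : ∀ p ∈ testSubmodule, ∃ k : L2,
      k =ᵐ[halfLine] (fun x => ((x⁻¹ : ℝ) : ℂ) * p.1 x) ∧
        ⟪p.2, k⟫_ℂ + ⟪k, p.2⟫_ℂ = ⟪k, k⟫_ℂ := by
    rintro ⟨v, v'⟩ ⟨φ, hφ, hφc, hφs, h1, h2⟩
    have hac : ACloc φ := acloc_of_contDiffOn (hφ.of_le (by simp)).contDiffOn
    have hcs := compactlySupported_of_tsupport hφc hφs
    have hcont : ContinuousOn (fun x : ℝ => ((x⁻¹ : ℝ) : ℂ)) (Ioi 0) :=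
      Complex.continuous_ofReal.comp_continuousOn
        (continuousOn_inv₀.mono fun x hx => ne_of_gt hx)
    have hm := memLp_of_compactlySupported (hcont.mul hac.continuousOn) (hcs.mul_left _)
    have hk := MemLp.coeFn_toLp hm
    refine ⟨hm.toLp _, ?_, ?_⟩
    · filter_upwards [hk, h1] with x hx h1
      rw [hx, h1]
      rfl
    · exact inner_deriv_add_inner_deriv hac hac hcs h2 hk h2 hk
  obtain ⟨s, hs, hlim⟩ := mem_closure_iff_seq_limit.1 hu
  choose k hk1 hk2 using fun n => hardyTest (s n) (hs n)
  have h1 : Tendsto (fun n => (s n).1) atTop (𝓝 u) := (continuous_fst.tendsto _).comp hlim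
  have h2 : Tendsto (fun n => (s n).2) atTop (𝓝 u') := (continuous_snd.tendsto _).comp hlim
  have hdist : ∀ n m, dist (k n) (k m) ≤ 2 * dist (s n).2 (s m).2 := by
    intro n m
    obtain ⟨l, hl1, hl2⟩ := hardyTest (s n - s m) (testSubmodule.sub_mem (hs n) (hs m))
    have : l = k n - k m := by
      refine Lp.ext ?_
      filter_upwards [hl1, hk1 n, hk1 m, Lp.coeFn_sub (k n) (k m),
        Lp.coeFn_sub (s n).1 (s m).1] with x e1 e2 e3 e4 e5
      rw [e1, e4, Pi.sub_apply, e2, e3, Prod.fst_sub, e5, Pi.sub_apply]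
      ring
    rw [dist_eq_norm, dist_eq_norm, ← this, ← Prod.snd_sub]
    exact bound _ _ hl2
  have hcau : CauchySeq k := by
    have h3 := h2.cauchySeq
    rw [Metric.cauchySeq_iff] at h3 ⊢
    intro ε hε
    obtain ⟨N, hN⟩ := h3 (ε / 2) (by positivity)
    refine ⟨N, fun m hm n hn => ?_⟩
    have := hN m hm n hn
    linarith [hdist m n]
  obtain ⟨h, hh⟩ := cauchySeq_tendsto_of_complete hcau
  have hid : ⟪u', h⟫_ℂ + ⟪h, u'⟫_ℂ = ⟪h, h⟫_ℂ := by
    refine tendsto_nhds_unique ((h2.inner hh).add (hh.inner h2)) ?_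
    simp only [hk2]
    exact hh.inner hh
  refine ⟨h, ?_, bound _ _ hid, hid⟩
  exact (isClosed_ae_eq_mul fun x => x⁻¹).mem_of_tendsto (h1.prodMk_nhds hh)
    (Eventually.of_forall hk1)

/-! ### The form domain as a Hilbert space -/

/-- `v'` is the derivative of `v` in `H¹₀(0, ∞)` and `k` is `v / x`. -/
structure IsHardyTriple (v v' k : L2) : Prop where
  isH10 : IsH10 v v'
  ae_eq : k =ᵐ[halfLine] fun x => ((x⁻¹ : ℝ) : ℂ) * v x

/-- Being equal almost everywhere to `m` times a function is a linear condition. -/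
lemma ae_eq_mul_add {m : ℝ → ℝ} {u w u' w' : L2}
    (h : w =ᵐ[halfLine] fun x => (m x : ℂ) * u x) (h' : w' =ᵐ[halfLine] fun x => (m x : ℂ) * u' x) :
    (w + w' : L2) =ᵐ[halfLine] fun x => (m x : ℂ) * (u + u' : L2) x := by
  filter_upwards [h, h', Lp.coeFn_add w w', Lp.coeFn_add u u'] with x h1 h2 h3 h4
  rw [h3, h4, Pi.add_apply, Pi.add_apply, h1, h2, mul_add]

lemma ae_eq_mul_smul {m : ℝ → ℝ} {u w : L2} (c : ℂ)
    (h : w =ᵐ[halfLine] fun x => (m x : ℂ) * u x) :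
    (c • w : L2) =ᵐ[halfLine] fun x => (m x : ℂ) * (c • u : L2) x := by
  filter_upwards [h, Lp.coeFn_smul c w, Lp.coeFn_smul c u] with x h1 h2 h3
  rw [h2, h3, Pi.smul_apply, Pi.smul_apply, h1, smul_eq_mul, smul_eq_mul]
  ring

lemma ae_eq_mul_zero (m : ℝ → ℝ) : (0 : L2) =ᵐ[halfLine] fun x => (m x : ℂ) * (0 : L2) x := by
  filter_upwards [Lp.coeFn_zero ℂ 2 halfLine] with x h1
  rw [h1, Pi.zero_apply, mul_zero]

namespace IsHardyTriple

variable {v v' k w w' l : L2}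

lemma add (h : IsHardyTriple v v' k) (h' : IsHardyTriple w w' l) :
    IsHardyTriple (v + w) (v' + w') (k + l) :=
  ⟨h10Submodule.add_mem h.isH10 h'.isH10, ae_eq_mul_add h.ae_eq h'.ae_eq⟩

lemma smul (c : ℂ) (h : IsHardyTriple v v' k) : IsHardyTriple (c • v) (c • v') (c • k) :=
  ⟨h10Submodule.smul_mem c h.isH10, ae_eq_mul_smul c h.ae_eq⟩

lemma zero : IsHardyTriple 0 0 0 := ⟨h10Submodule.zero_mem, ae_eq_mul_zero _⟩

lemma sub (h : IsHardyTriple v v' k) (h' : IsHardyTriple w w' l) :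
    IsHardyTriple (v - w) (v' - w') (k - l) := by
  simpa only [neg_one_smul, ← sub_eq_add_neg] using h.add (h'.smul (-1))

lemma hardy (h : IsHardyTriple v v' k) :
    ‖k‖ ≤ 2 * ‖v'‖ ∧ ⟪v', k⟫_ℂ + ⟪k, v'⟫_ℂ = ⟪k, k⟫_ℂ := by
  obtain ⟨k', h1, h2, h3⟩ := h.isH10.exists_hardy
  have : k' = k := Lp.ext (h1.trans h.ae_eq.symm)
  subst this
  exact ⟨h2, h3⟩

/-- The cross term of the square is `-2γ Re ⟪v', k⟫ = -γ ‖k‖²` by the Hardy identity. This absorbs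
the singular part `(γ² - γ)/x²` of the potential into a square. -/
lemma norm_sq_sub (h : IsHardyTriple v v' k) (γ : ℝ) :
    ‖v' - (γ : ℂ) • k‖ ^ 2 = ‖v'‖ ^ 2 + (γ ^ 2 - γ) * ‖k‖ ^ 2 := by
  have h1 := h.hardy.2
  rw [← inner_conj_symm k v', Complex.add_conj, inner_self_eq_norm_sq_to_K] at h1
  have h2 : 2 * (⟪v', k⟫_ℂ).re = ‖k‖ ^ 2 := by
    rw [← Complex.ofReal_inj, h1]
    push_cast
    rfl
  rw [norm_sub_sq (𝕜 := ℂ), inner_smul_right, RCLike.re_eq_complex_re, Complex.re_ofReal_mul,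
    norm_smul, Complex.norm_real, mul_pow, Real.norm_eq_abs, sq_abs]
  linear_combination (-γ) * h2

/-- For `γ ≥ 1` the extra term of `norm_sq_sub` is nonnegative. For `γ < 1` it is negative, and `‖k‖
≤ 2 ‖v'‖` bounds the square below by `(1 + 4(γ² - γ)) ‖v'‖² = (2γ - 1)² ‖v'‖²`. -/
lemma norm_le (h : IsHardyTriple v v' k) {γ : ℝ} (hγ : 1 / 2 < γ) :
    min 1 (2 * γ - 1) * ‖v'‖ ≤ ‖v' - (γ : ℂ) • k‖ := by
  have hpos : 0 ≤ min 1 (2 * γ - 1) := le_min zero_le_one (by linarith)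
  refine abs_le_of_sq_le_sq' ?_ (norm_nonneg _) |>.2
  rw [h.norm_sq_sub, mul_pow]
  have h1 := h.hardy.1
  have h2 : ‖k‖ ^ 2 ≤ 4 * ‖v'‖ ^ 2 := by nlinarith [norm_nonneg k, norm_nonneg v']
  rcases le_total 1 γ with hg | hg
  · have h3 : min 1 (2 * γ - 1) ^ 2 ≤ 1 := pow_le_one₀ hpos (min_le_left _ _)
    have h4 : 0 ≤ (γ ^ 2 - γ) * ‖k‖ ^ 2 := mul_nonneg (by nlinarith) (sq_nonneg _)
    nlinarith [sq_nonneg ‖v'‖]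
  · have h3 : min 1 (2 * γ - 1) ^ 2 ≤ (2 * γ - 1) ^ 2 :=
      pow_le_pow_left₀ hpos (min_le_right _ _) 2
    have h4 : (γ ^ 2 - γ) * (4 * ‖v'‖ ^ 2) ≤ (γ ^ 2 - γ) * ‖k‖ ^ 2 :=
      mul_le_mul_of_nonpos_left h2 (by nlinarith)
    nlinarith [mul_le_mul_of_nonneg_right h3 (sq_nonneg ‖v'‖)]

end IsHardyTriple

/-- The Hilbert space `L² × L² × L²`. -/
abbrev L2Triple : Type := WithLp 2 (L2 × WithLp 2 (L2 × L2))

/-- The triples `(u, u' - γ u / x, m u)` for `u ∈ H¹₀(0, ∞)` with `m u ∈ L²(0, ∞)`. -/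
def formSpace (γ : ℝ) (m : ℝ → ℝ) : Submodule ℂ L2Triple where
  carrier := {k | ∃ u' h, IsHardyTriple k.fst u' h ∧ k.snd.fst = u' - (γ : ℂ) • h ∧
    k.snd.snd =ᵐ[halfLine] fun x => (m x : ℂ) * k.fst x}
  zero_mem' := ⟨0, 0, IsHardyTriple.zero, by simp, ae_eq_mul_zero _⟩
  add_mem' := by
    rintro k l ⟨u', h, h1, h2, h3⟩ ⟨v', g, h1', h2', h3'⟩
    refine ⟨_, _, h1.add h1', ?_, ae_eq_mul_add h3 h3'⟩
    change k.snd.fst + l.snd.fst = _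
    rw [h2, h2', smul_add]
    abel
  smul_mem' := by
    rintro c k ⟨u', h, h1, h2, h3⟩
    refine ⟨_, _, h1.smul c, ?_, ae_eq_mul_smul c h3⟩
    change c • k.snd.fst = _
    rw [h2, smul_sub, smul_comm]

/-- Convergence of `u' - γ u/x` forces that of `u'` by `IsHardyTriple.norm_le`, and then that of
`u/x` by Hardy's inequality. The defining relations are closed. -/
lemma isClosed_formSpace {γ : ℝ} (hγ : 1 / 2 < γ) (m : ℝ → ℝ) :
    IsClosed (formSpace γ m : Set L2Triple) := by
  refine isClosed_of_closure_subset fun k hk => ?_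
  obtain ⟨s, hs, hlim⟩ := mem_closure_iff_seq_limit.1 hk
  choose u' h h1 h2 h3 using hs
  have l1 : Tendsto (fun n => (s n).fst) atTop (𝓝 k.fst) :=
    ((WithLp.fstL 2 ℂ L2 (WithLp 2 (L2 × L2))).continuous.tendsto _).comp hlim
  have l0 : Tendsto (fun n => (s n).snd) atTop (𝓝 k.snd) :=
    ((WithLp.sndL 2 ℂ L2 (WithLp 2 (L2 × L2))).continuous.tendsto _).comp hlim
  have l2 : Tendsto (fun n => (s n).snd.fst) atTop (𝓝 k.snd.fst) :=
    ((WithLp.fstL 2 ℂ L2 L2).continuous.tendsto _).comp l0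
  have l3 : Tendsto (fun n => (s n).snd.snd) atTop (𝓝 k.snd.snd) :=
    ((WithLp.sndL 2 ℂ L2 L2).continuous.tendsto _).comp l0
  set c := min 1 (2 * γ - 1)
  have hc : 0 < c := lt_min one_pos (by linarith)
  have hd1 : ∀ n j, c * dist (u' n) (u' j) ≤ dist (s n).snd.fst (s j).snd.fst := by
    intro n j
    rw [dist_eq_norm, dist_eq_norm, h2, h2]
    refine (((h1 n).sub (h1 j)).norm_le hγ).trans_eq ?_
    rw [smul_sub]
    congr 1
    abel
  have hd2 : ∀ n j, dist (h n) (h j) ≤ 2 * dist (u' n) (u' j) := by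
    intro n j
    rw [dist_eq_norm, dist_eq_norm]
    exact ((h1 n).sub (h1 j)).hardy.1
  have cau : ∀ {a : ℕ → L2} {b : ℕ → L2} {C : ℝ}, 0 < C →
      (∀ n j, C * dist (b n) (b j) ≤ dist (a n) (a j)) → CauchySeq a → CauchySeq b := by
    intro a b C hC hab ha
    rw [Metric.cauchySeq_iff] at ha ⊢
    intro ε hε
    obtain ⟨N, hN⟩ := ha (C * ε) (by positivity)
    exact ⟨N, fun n hn j hj =>
      lt_of_mul_lt_mul_left ((hab n j).trans_lt (hN n hn j hj)) hC.le⟩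
  have c1 : CauchySeq u' := cau hc hd1 l2.cauchySeq
  have c2 : CauchySeq h := cau (C := 1 / 2) (by norm_num)
    (fun n j => by linarith [hd2 n j]) c1
  obtain ⟨v', hv'⟩ := cauchySeq_tendsto_of_complete c1
  obtain ⟨g, hg⟩ := cauchySeq_tendsto_of_complete c2
  refine ⟨v', g, ⟨?_, ?_⟩, ?_, ?_⟩
  · exact isClosed_h10Submodule.mem_of_tendsto (l1.prodMk_nhds hv')
      (Eventually.of_forall fun n => (h1 n).isH10)
  · exact (isClosed_ae_eq_mul fun x => x⁻¹).mem_of_tendsto (l1.prodMk_nhds hg)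
      (Eventually.of_forall fun n => (h1 n).ae_eq)
  · refine tendsto_nhds_unique l2 ?_
    simp only [h2]
    exact hv'.sub (hg.const_smul _)
  · exact (isClosed_ae_eq_mul m).mem_of_tendsto (l1.prodMk_nhds l3) (Eventually.of_forall h3)

/-- The form domain as a Hilbert space; the norm is the one of `L² × L² × L²`. -/
def FormDomain (γ : ℝ) (m : ℝ → ℝ) : Type := formSpace γ m

namespace FormDomain

variable {γ : ℝ} {m : ℝ → ℝ}

instance : NormedAddCommGroup (FormDomain γ m) :=
  inferInstanceAs (NormedAddCommGroup (formSpace γ m))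

instance : InnerProductSpace ℂ (FormDomain γ m) :=
  inferInstanceAs (InnerProductSpace ℂ (formSpace γ m))

lemma completeSpace (hγ : 1 / 2 < γ) (m : ℝ → ℝ) : CompleteSpace (FormDomain γ m) :=
  (isClosed_formSpace hγ m).completeSpace_coe

/-- The underlying triple of an element of the form domain. -/
def triple (k : FormDomain γ m) : L2Triple := Subtype.val k

lemma spec (k : FormDomain γ m) : ∃ u' h, IsHardyTriple k.triple.fst u' h ∧
    k.triple.snd.fst = u' - (γ : ℂ) • h ∧
    k.triple.snd.snd =ᵐ[halfLine] fun x => (m x : ℂ) * k.triple.fst x := k.2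

lemma norm_eq (k : FormDomain γ m) : ‖k‖ = ‖k.triple‖ := rfl

end FormDomain

/-- The embedding of the form domain into `L²(0, ∞)`. -/
def formEmbedding (γ : ℝ) (m : ℝ → ℝ) : FormDomain γ m →L[ℂ] L2 :=
  LinearMap.mkContinuous
    { toFun := fun k => k.triple.fst
      map_add' := fun _ _ => rfl
      map_smul' := fun _ _ => rfl } 1 fun k => by
    rw [one_mul, FormDomain.norm_eq]
    refine abs_le_of_sq_le_sq' ?_ (norm_nonneg _) |>.2
    rw [WithLp.prod_norm_sq_eq_of_L2]
    exact le_add_of_nonneg_right (sq_nonneg _)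

/-- The first component of a triple determines `u'`, `u/x` and `m u`. This is the source of the
closability of the form. -/
lemma formEmbedding_injective (γ : ℝ) (m : ℝ → ℝ) : Function.Injective (formEmbedding γ m) := by
  rw [injective_iff_map_eq_zero]
  rintro ⟨k, u', h, h1, h2, h3⟩ hk
  have hk : k.fst = 0 := hk
  rw [hk] at h1 h3
  have hu' : u' = 0 := by
    refine Lp.ext ((h1.isH10.deriv_ae_eq (f := 0) ?_ (Lp.coeFn_zero _ _ _)).trans
      (EventuallyEq.trans ?_ (Lp.coeFn_zero _ _ _).symm))
    · exact acloc_of_contDiffOn contDiffOn_const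
    · exact Eventually.of_forall fun x => deriv_const x (0 : ℂ)
  have hh : h = 0 := Lp.ext (h1.ae_eq.trans (ae_eq_mul_zero _).symm)
  have h4 : k.snd.snd = 0 := Lp.ext (h3.trans (ae_eq_mul_zero _).symm)
  have h5 : k.snd.fst = 0 := by rw [h2, hu', hh, smul_zero, sub_zero]
  have hk0 : ‖k‖ ^ 2 = 0 := by
    rw [WithLp.prod_norm_sq_eq_of_L2, WithLp.prod_norm_sq_eq_of_L2, hk, h4, h5]
    simp
  exact Subtype.ext (norm_eq_zero.1 (pow_eq_zero_iff two_ne_zero |>.1 hk0))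

/-- Assumptions on the multiplier `m = √(q + μ - β / x²)`, where `β = γ² - γ`. -/
structure IsFormMultiplier (q : ℝ → ℝ) (μ γ : ℝ) (m : ℝ → ℝ) : Prop where
  locallyIntegrableOn : LocallyIntegrableOn q (Ioi 0)
  aestronglyMeasurable : AEStronglyMeasurable m halfLine
  sq_eq : ∀ᵐ x ∂halfLine, m x ^ 2 = q x + μ - (γ ^ 2 - γ) * (x⁻¹) ^ 2

namespace IsFormMultiplier

variable {q : ℝ → ℝ} {μ γ : ℝ} {m : ℝ → ℝ} (hm : IsFormMultiplier q μ γ m)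
include hm

lemma locallyIntegrableOn_ofReal : LocallyIntegrableOn (fun x => (q x : ℂ)) (Ioi 0) := by
  intro x hx
  obtain ⟨s, hs, h⟩ := hm.locallyIntegrableOn x hx
  exact ⟨s, hs, h.ofReal⟩

lemma integrable_mul {g : ℝ → ℂ} (hg : ContinuousOn g (Ioi 0)) (hc : CompactlySupported g) :
    Integrable (fun x => (q x : ℂ) * g x) halfLine :=
  integrable_mul_of_compactlySupported hm.locallyIntegrableOn_ofReal hg hc

/-- The integrability of `m² |u|²` is equivalent to that of `q |u|²`. -/
lemma integrable_iff {u u' : L2} (hu : IsH10 u u') :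
    Integrable (fun x => q x * ‖u x‖ ^ 2) halfLine ↔
      MemLp (fun x => (m x : ℂ) * u x) 2 halfLine := by
  obtain ⟨h, hh, -, -⟩ := hu.exists_hardy
  have hmeas : AEStronglyMeasurable (fun x => (m x : ℂ) * u x) halfLine :=
    (Complex.continuous_ofReal.comp_aestronglyMeasurable hm.aestronglyMeasurable).mul
      (Lp.aestronglyMeasurable u)
  have i1 := (memLp_two_iff_integrable_sq_norm (Lp.aestronglyMeasurable u)).1 (Lp.memLp u)
  have i2 := (memLp_two_iff_integrable_sq_norm (Lp.aestronglyMeasurable h)).1 (Lp.memLp h)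
  rw [memLp_two_iff_integrable_sq_norm hmeas]
  -- The two densities differ by a combination of `|u|²` and `|u/x|²`, both integrable, the latter
  -- by Hardy's inequality.
  have e : (fun x => ‖(m x : ℂ) * u x‖ ^ 2) =ᵐ[halfLine] fun x => q x * ‖u x‖ ^ 2 +
      (μ * ‖u x‖ ^ 2 - (γ ^ 2 - γ) * ‖h x‖ ^ 2) := by
    filter_upwards [hm.sq_eq, hh] with x h1 h2
    rw [h2, norm_mul, norm_mul, Complex.norm_real, Complex.norm_real, mul_pow, mul_pow,
      Real.norm_eq_abs, Real.norm_eq_abs, sq_abs, sq_abs, h1]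
    ring
  have i3 : Integrable (fun x => μ * ‖u x‖ ^ 2 - (γ ^ 2 - γ) * ‖h x‖ ^ 2) halfLine :=
    (i1.const_mul μ).sub (i2.const_mul _)
  rw [integrable_congr e]
  refine ⟨fun h => h.add i3, fun h => ?_⟩
  refine (h.sub i3).congr (Eventually.of_forall fun x => ?_)
  simp

/-- The range of the embedding is `H¹₀((0, ∞); q)`. -/
lemma range_formEmbedding : Set.range (formEmbedding γ m) = H10q q := by
  ext u
  constructor
  · rintro ⟨⟨k, u', h, h1, h2, h3⟩, rfl⟩
    refine ⟨⟨u', h1.isH10⟩, (hm.integrable_iff h1.isH10).2 ?_⟩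
    exact (memLp_congr_ae h3).1 (Lp.memLp _)
  · rintro ⟨⟨u', hu⟩, hi⟩
    obtain ⟨h, hh, -, -⟩ := hu.exists_hardy
    have hL := (hm.integrable_iff hu).1 hi
    exact ⟨⟨WithLp.toLp 2 (u, WithLp.toLp 2 (u' - (γ : ℂ) • h, hL.toLp _)),
      u', h, ⟨hu, hh⟩, rfl, hL.coeFn_toLp⟩, rfl⟩

/-- The term `(γ² - γ) ‖u/x‖²` from the completed square cancels the one subtracted in `m²`. In the
shift `μ + 1`, the `μ` comes from `m²` and the `1` from the first component. -/
lemma norm_sq_eq (k : FormDomain γ m) {u' : L2} (hu' : IsH10 (formEmbedding γ m k) u') :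
    ‖k‖ ^ 2 = (∫ x, ‖u' x‖ ^ 2 ∂halfLine) + (∫ x, q x * ‖formEmbedding γ m k x‖ ^ 2 ∂halfLine) +
      (μ + 1) * ‖formEmbedding γ m k‖ ^ 2 := by
  obtain ⟨k, v', h, h1, h2, h3⟩ := k
  have hu' : IsH10 k.fst u' := hu'
  change ‖k‖ ^ 2 = _ + (∫ x, q x * ‖k.fst x‖ ^ 2 ∂halfLine) + (μ + 1) * ‖k.fst‖ ^ 2
  obtain ⟨f, hf, e1, e2⟩ := h1.isH10.exists_acloc
  have : v' = u' := Lp.ext (e2.trans (hu'.deriv_ae_eq hf e1).symm)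
  subst this
  rw [WithLp.prod_norm_sq_eq_of_L2, WithLp.prod_norm_sq_eq_of_L2, h2, h1.norm_sq_sub]
  rw [L2.norm_sq_eq_integral k.snd.snd, L2.norm_sq_eq_integral v', L2.norm_sq_eq_integral h,
    L2.norm_sq_eq_integral k.fst]
  have i0 := (hm.integrable_iff hu').2 ((memLp_congr_ae h3).1 (Lp.memLp _))
  have i1 := (memLp_two_iff_integrable_sq_norm (Lp.aestronglyMeasurable k.fst)).1 (Lp.memLp _)
  have i2 := (memLp_two_iff_integrable_sq_norm (Lp.aestronglyMeasurable h)).1 (Lp.memLp h)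
  have i3 : Integrable (fun x => μ * ‖k.fst x‖ ^ 2 - (γ ^ 2 - γ) * ‖h x‖ ^ 2) halfLine :=
    (i1.const_mul μ).sub (i2.const_mul _)
  have e : (fun x => ‖k.snd.snd x‖ ^ 2) =ᵐ[halfLine] fun x => q x * ‖k.fst x‖ ^ 2 +
      (μ * ‖k.fst x‖ ^ 2 - (γ ^ 2 - γ) * ‖h x‖ ^ 2) := by
    filter_upwards [hm.sq_eq, h1.ae_eq, h3] with x e1 e2 e3
    rw [e2, e3, norm_mul, norm_mul, Complex.norm_real, Complex.norm_real, mul_pow, mul_pow,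
      Real.norm_eq_abs, Real.norm_eq_abs, sq_abs, sq_abs, e1]
    ring
  rw [integral_congr_ae e, integral_add i0 i3, integral_sub (i1.const_mul μ) (i2.const_mul _),
    integral_const_mul, integral_const_mul]
  ring

/-- Compactly supported absolutely continuous functions with square integrable derivative belong to
the form domain. -/
lemma exists_formDomain {g : ℝ → ℂ} (hg : ACloc g) (hc : CompactlySupported g)
    (hg' : MemLp (deriv g) 2 halfLine) :
    ∃ k : FormDomain γ m, formEmbedding γ m k =ᵐ[halfLine] g := by
  have hu := memLp_of_compactlySupported hg.continuousOn hc
  have hH : IsH10 (hu.toLp _) (hg'.toLp _) := isH10_of_acloc hg hc hu.coeFn_toLp hg'.coeFn_toLp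
  have : hu.toLp _ ∈ H10q q := by
    refine ⟨⟨_, hH⟩, ?_⟩
    have := (hm.integrable_mul (hg.conj.mul hg).continuousOn (hc.mul_left _)).re
    refine this.congr ?_
    filter_upwards [hu.coeFn_toLp] with x hx
    rw [hx, Complex.conj_mul']
    norm_cast
  rw [← hm.range_formEmbedding] at this
  obtain ⟨k, hk⟩ := this
  exact ⟨k, by rw [hk]; exact hu.coeFn_toLp⟩

/-- The range contains the test functions, and only zero is orthogonal to all of them. -/
lemma denseRange_formEmbedding : DenseRange (formEmbedding γ m) := by
  let R := LinearMap.range (formEmbedding γ m : FormDomain γ m →ₗ[ℂ] L2)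
  have h := R.dense_iff_topologicalClosure_eq_top.2 (by
    rw [Submodule.topologicalClosure_eq_top_iff, Submodule.eq_bot_iff]
    intro u hu
    refine Lp.ext (EventuallyEq.trans (ae_eq_zero_of_integral_test (L2.locallyIntegrableOn u)
      fun φ hφ => ?_) (Lp.coeFn_zero _ _ _).symm)
    obtain ⟨k, hk⟩ := hm.exists_formDomain hφ.acloc hφ.compactlySupported (by
      rw [hφ.deriv_ofReal]
      exact memLp_test hφ.deriv)
    have h1 : ⟪formEmbedding γ m k, u⟫_ℂ = 0 := hu _ ⟨k, rfl⟩
    rw [L2.inner_eq_integral hk (EventuallyEq.refl _ _)] at h1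
    simpa only [Complex.conj_ofReal] using h1)
  exact h

/-- The inner product of the form domain, if one of the factors has compact support. -/
lemma inner_eq {k l : FormDomain γ m} {f g : ℝ → ℂ} (hf : ACloc f) (hg : ACloc g)
    (hc : CompactlySupported g) (hk : formEmbedding γ m k =ᵐ[halfLine] f)
    (hl : formEmbedding γ m l =ᵐ[halfLine] g) :
    Integrable (fun x => conj (deriv g x) * deriv f x) halfLine ∧
    ⟪l, k⟫_ℂ = (∫ x, conj (deriv g x) * deriv f x ∂halfLine) +
      ∫ x, ((q x + (μ + 1) : ℝ) : ℂ) * (conj (g x) * f x) ∂halfLine := by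
  obtain ⟨k, u', h, h1, h2, h3⟩ := k
  obtain ⟨l, v', j, h1', h2', h3'⟩ := l
  have hk : k.fst =ᵐ[halfLine] f := hk
  have hl : l.fst =ᵐ[halfLine] g := hl
  have hu' := h1.isH10.deriv_ae_eq hf hk
  have hv' := h1'.isH10.deriv_ae_eq hg hl
  have hh : h =ᵐ[halfLine] fun x => ((x⁻¹ : ℝ) : ℂ) * f x := by
    filter_upwards [h1.ae_eq, hk] with x e1 e2
    rw [e1, e2]
  have hj : j =ᵐ[halfLine] fun x => ((x⁻¹ : ℝ) : ℂ) * g x := by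
    filter_upwards [h1'.ae_eq, hl] with x e1 e2
    rw [e1, e2]
  have hw : k.snd.snd =ᵐ[halfLine] fun x => (m x : ℂ) * f x := by
    filter_upwards [h3, hk] with x e1 e2
    rw [e1, e2]
  have hw' : l.snd.snd =ᵐ[halfLine] fun x => (m x : ℂ) * g x := by
    filter_upwards [h3', hl] with x e1 e2
    rw [e1, e2]
  -- The polarized Hardy identity is available with the compactly supported function in the second
  -- slot; conjugation exchanges the slots.
  have key : ⟪v', h⟫_ℂ + ⟪j, u'⟫_ℂ = ⟪j, h⟫_ℂ := by
    have := congrArg conj (inner_deriv_add_inner_deriv hf hg hc hu' hh hv' hj)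
    rwa [map_add, inner_conj_symm, inner_conj_symm, inner_conj_symm, add_comm] at this
  refine ⟨L2.integrable_conj_mul hv' hu', ?_⟩
  change ⟪l, k⟫_ℂ = _
  have e0 : ⟪v' - (γ : ℂ) • j, u' - (γ : ℂ) • h⟫_ℂ =
      ⟪v', u'⟫_ℂ + ((γ ^ 2 - γ : ℝ) : ℂ) * ⟪j, h⟫_ℂ := by
    rw [inner_sub_left, inner_sub_right, inner_sub_right, inner_smul_left, inner_smul_left,
      inner_smul_right, inner_smul_right, Complex.conj_ofReal]
    push_cast
    linear_combination (-(γ : ℂ)) * key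
  rw [WithLp.prod_inner_apply, WithLp.prod_inner_apply]
  change ⟪l.fst, k.fst⟫_ℂ + (⟪l.snd.fst, k.snd.fst⟫_ℂ + ⟪l.snd.snd, k.snd.snd⟫_ℂ) = _
  have i1 := L2.integrable_conj_mul hl hk
  have i2 := L2.integrable_conj_mul hj hh
  have i3 := L2.integrable_conj_mul hw' hw
  have i23 : Integrable (fun x => ((γ ^ 2 - γ : ℝ) : ℂ) *
      (conj (((x⁻¹ : ℝ) : ℂ) * g x) * (((x⁻¹ : ℝ) : ℂ) * f x)) +
      conj ((m x : ℂ) * g x) * ((m x : ℂ) * f x)) halfLine := (i2.const_mul _).add i3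
  rw [h2, h2', e0, L2.inner_eq_integral hl hk, L2.inner_eq_integral hv' hu',
    L2.inner_eq_integral hj hh, L2.inner_eq_integral hw' hw, add_assoc, add_left_comm,
    ← integral_const_mul, ← integral_add (i2.const_mul _) i3,
    ← integral_add i1 i23]
  congr 1
  refine integral_congr_ae ?_
  filter_upwards [hm.sq_eq] with x hx
  simp only [map_mul, Complex.conj_ofReal]
  have hx : (m x : ℂ) ^ 2 = q x + μ - (γ ^ 2 - γ) * ((x⁻¹ : ℝ) : ℂ) ^ 2 := by exact_mod_cast hx
  push_cast at hx ⊢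
  linear_combination (conj (g x) * f x) * hx

end IsFormMultiplier

/-! ### The differential expression and the form -/

lemma MaxDomainFun.memLp_deriv {q : ℝ → ℝ} {g : ℝ → ℂ} (hg : MaxDomainFun q g)
    (hc : CompactlySupported g) : MemLp (deriv g) 2 halfLine :=
  memLp_of_compactlySupported hg.ac_deriv.continuousOn hc.deriv

namespace IsFormMultiplier

variable {q : ℝ → ℝ} {μ γ : ℝ} {m : ℝ → ℝ} (hm : IsFormMultiplier q μ γ m)
include hm

lemma integrable_potential_mul {f g : ℝ → ℂ} (hf : ACloc f) (hg : ACloc g)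
    (hc : CompactlySupported g) :
    Integrable (fun x => ((q x + (μ + 1) : ℝ) : ℂ) * (conj (g x) * f x)) halfLine := by
  have hgf := hg.conj.mul hf
  have hcs := hc.conj.mul_right f
  have h1 := hm.integrable_mul hgf.continuousOn hcs
  have h2 := integrable_mul_of_compactlySupported
    (continuousOn_locallyIntegrableOn (f := fun _ => ((μ + 1 : ℝ) : ℂ)) continuousOn_const)
    hgf.continuousOn hcs
  refine (h1.add h2).congr (Eventually.of_forall fun x => ?_)
  simp only [Pi.add_apply]
  push_cast
  ring

/-- The form, if the second factor has compact support and belongs to the maximal domain. -/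
lemma inner_eq_inner_tau_left {l k : FormDomain γ m} {g : ℝ → ℂ} (hg : MaxDomainFun q g)
    (hc : CompactlySupported g) {w : L2} (hl : formEmbedding γ m l =ᵐ[halfLine] g)
    (hw : w =ᵐ[halfLine] tau q g) :
    ⟪l, k⟫_ℂ = ⟪w + ((μ + 1 : ℝ) : ℂ) • formEmbedding γ m l, formEmbedding γ m k⟫_ℂ := by
  obtain ⟨u', h, h1, -⟩ := k.spec
  obtain ⟨f, hf, hk, -⟩ := h1.isH10.exists_acloc
  have hk : formEmbedding γ m k =ᵐ[halfLine] f := hk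
  have hF : (w + ((μ + 1 : ℝ) : ℂ) • formEmbedding γ m l : L2) =ᵐ[halfLine]
      fun x => tau q g x + ((μ + 1 : ℝ) : ℂ) * g x := by
    filter_upwards [Lp.coeFn_add w (((μ + 1 : ℝ) : ℂ) • formEmbedding γ m l),
      Lp.coeFn_smul ((μ + 1 : ℝ) : ℂ) (formEmbedding γ m l), hl, hw] with x e1 e2 e3 e4
    rw [e1, Pi.add_apply, e2, Pi.smul_apply, e3, e4, smul_eq_mul]
  have i1 := hm.integrable_potential_mul hf hg.ac hc
  have i2 := L2.integrable_conj_mul hF hk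
  -- Only one derivative of `f` is at hand, so it is moved onto `g'`, whose compact support removes
  -- the boundary terms.
  have ibp := hf.integral_mul_deriv hg.ac_deriv.conj hc.deriv.conj
  rw [(hm.inner_eq hf hg.ac hc hk hl).2, L2.inner_eq_integral hF hk, ← eq_sub_iff_add_eq,
    ← integral_sub i2 i1]
  have e : ∫ x, conj (deriv g x) * deriv f x ∂halfLine =
      ∫ x, deriv f x * conj (deriv g x) ∂halfLine := by simp only [mul_comm]
  rw [e, ← neg_eq_iff_eq_neg.2 ibp, ← integral_neg]
  refine integral_congr_ae ?_
  filter_upwards [hg.ac_deriv.ae_differentiableAt] with x hx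
  have h2 : deriv (fun x => conj (deriv g x)) x = conj (deriv (deriv g) x) :=
    hx.hasDerivAt.star.deriv
  simp only [h2, tau, map_add, map_neg, map_mul, Complex.conj_ofReal]
  push_cast
  ring

/-- The form, if the second factor has compact support and the first factor belongs to the maximal
domain. -/
lemma inner_eq_inner_tau_right {l k : FormDomain γ m} {f g : ℝ → ℂ} (hf : MaxDomainFun q f)
    (hg : ACloc g) (hc : CompactlySupported g) {w : L2} (hk : formEmbedding γ m k =ᵐ[halfLine] f)
    (hl : formEmbedding γ m l =ᵐ[halfLine] g) (hw : w =ᵐ[halfLine] tau q f) :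
    ⟪l, k⟫_ℂ = ⟪formEmbedding γ m l, w + ((μ + 1 : ℝ) : ℂ) • formEmbedding γ m k⟫_ℂ := by
  have hF : (w + ((μ + 1 : ℝ) : ℂ) • formEmbedding γ m k : L2) =ᵐ[halfLine]
      fun x => tau q f x + ((μ + 1 : ℝ) : ℂ) * f x := by
    filter_upwards [Lp.coeFn_add w (((μ + 1 : ℝ) : ℂ) • formEmbedding γ m k),
      Lp.coeFn_smul ((μ + 1 : ℝ) : ℂ) (formEmbedding γ m k), hk, hw] with x e1 e2 e3 e4
    rw [e1, Pi.add_apply, e2, Pi.smul_apply, e3, e4, smul_eq_mul]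
  have i1 := hm.integrable_potential_mul hf.ac hg hc
  have i2 := L2.integrable_conj_mul hl hF
  have ibp := hf.ac_deriv.integral_mul_deriv hg.conj hc.conj
  rw [(hm.inner_eq hf.ac hg hc hk hl).2, L2.inner_eq_integral hl hF, ← eq_sub_iff_add_eq,
    ← integral_sub i2 i1]
  have e : ∫ x, conj (deriv g x) * deriv f x ∂halfLine =
      ∫ x, deriv f x * deriv (fun x => conj (g x)) x ∂halfLine := by
    refine integral_congr_ae ?_
    filter_upwards [hg.ae_differentiableAt] with x hx
    have h2 : deriv (fun x => conj (g x)) x = conj (deriv g x) := hx.hasDerivAt.star.deriv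
    simp only [h2, mul_comm]
  rw [e, ibp, ← integral_neg]
  refine integral_congr_ae (Eventually.of_forall fun x => ?_)
  simp only [tau]
  push_cast
  ring

/-- Elements of the form domain that are represented by an element of `L²(0, ∞)` belong to the
maximal domain. -/
lemma exists_maxDomainFun {k : FormDomain γ m} {F : L2}
    (hF : ∀ l, ⟪l, k⟫_ℂ = ⟪formEmbedding γ m l, F⟫_ℂ) :
    ∃ f, MaxDomainFun q f ∧ formEmbedding γ m k =ᵐ[halfLine] f := by
  obtain ⟨u', h, h1, -⟩ := k.spec
  obtain ⟨f, hf, hk, hu'⟩ := h1.isH10.exists_acloc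
  have hk : formEmbedding γ m k =ᵐ[halfLine] f := hk
  -- The representation of `k` by `F` says weakly that `-f'' + (q + μ + 1) f = F`, so `G` is the
  -- weak derivative of `f'`.
  set G : ℝ → ℂ := fun x => ((q x + (μ + 1) : ℝ) : ℂ) * f x - F x with hG
  have hGl : LocallyIntegrableOn G (Ioi 0) := by
    refine LocallyIntegrableOn.sub ?_ (L2.locallyIntegrableOn F)
    have h3 : LocallyIntegrableOn (fun x => ((q x + (μ + 1) : ℝ) : ℂ)) (Ioi 0) := by
      have := hm.locallyIntegrableOn_ofReal.add
        (continuousOn_locallyIntegrableOn (f := fun _ => ((μ + 1 : ℝ) : ℂ)) continuousOn_const)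
      refine (locallyIntegrableOn_congr (Eventually.of_forall fun x => ?_)).1 this
      simp
    exact h3.mul_continuousOn hf.continuousOn isOpen_Ioi.isLocallyClosed
  have hweak : ∀ φ, IsTest φ → ∫ x, ((deriv φ x : ℝ) : ℂ) * deriv f x ∂halfLine =
      -∫ x, (φ x : ℂ) * G x ∂halfLine := by
    intro φ hφ
    obtain ⟨l, hl⟩ := hm.exists_formDomain hφ.acloc hφ.compactlySupported (by
      rw [hφ.deriv_ofReal]
      exact memLp_test hφ.deriv)
    have h4 := hF l
    have i1 := hm.integrable_potential_mul hf hφ.acloc hφ.compactlySupported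
    have i2 := L2.integrable_conj_mul hl (EventuallyEq.refl _ F)
    rw [(hm.inner_eq hf hφ.acloc hφ.compactlySupported hk hl).2,
      L2.inner_eq_integral hl (EventuallyEq.refl _ F), ← eq_sub_iff_add_eq, ← integral_sub i2 i1,
      hφ.deriv_ofReal] at h4
    simp only [Complex.conj_ofReal] at h4
    rw [h4, ← integral_neg]
    refine integral_congr_ae (Eventually.of_forall fun x => ?_)
    simp only [hG]
    ring
  obtain ⟨W, hW, hW1, hW2⟩ := exists_acloc_of_weakDeriv hf.locallyIntegrableOn_deriv hGl hweak
  -- So far `W` equals `f'` only almost everywhere. A primitive of the continuous `W` is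
  -- differentiable at every point with derivative exactly `W`, as the maximal domain requires.
  obtain ⟨c, hc⟩ := exists_ae_eq_primitive_of_weakDeriv (L2.locallyIntegrableOn _)
    (continuousOn_locallyIntegrableOn hW.continuousOn) fun φ hφ => by
      rw [h1.isH10.integral_deriv_mul hφ, neg_inj]
      refine integral_congr_ae ?_
      filter_upwards [hu', hW1] with x e1 e2
      simp only [e1, e2]
  have hc : formEmbedding γ m k =ᵐ[halfLine] fun x => c + ∫ t in (1 : ℝ)..x, W t := hc
  have hd : ∀ x, 0 < x → HasDerivAt (fun x => c + ∫ t in (1 : ℝ)..x, W t) (W x) x :=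
    fun x hx => hasDerivAt_const_add_primitive hW.continuousOn c hx
  have hdW : EqOn W (deriv fun x => c + ∫ t in (1 : ℝ)..x, W t) (Ioi 0) :=
    fun x hx => (hd x hx).deriv.symm
  refine ⟨_, ⟨acloc_const_add_primitive (continuousOn_locallyIntegrableOn hW.continuousOn) c,
    fun x hx => (hd x hx).differentiableAt.differentiableWithinAt, hW.congr hdW,
    (memLp_congr_ae hc).1 (Lp.memLp _), ?_⟩, hc⟩
  refine (memLp_congr_ae ?_).1 (Lp.memLp (F - ((μ + 1 : ℝ) : ℂ) • formEmbedding γ m k))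
  filter_upwards [Lp.coeFn_sub F (((μ + 1 : ℝ) : ℂ) • formEmbedding γ m k),
    Lp.coeFn_smul ((μ + 1 : ℝ) : ℂ) (formEmbedding γ m k), hk, hc, hW2,
    ae_restrict_mem measurableSet_Ioi] with x e1 e2 e3 e4 e5 hx
  have e6 := deriv_eqOn_nhds hdW hx
  rw [tau, ← e6, ← e5, ← e4, e1, Pi.sub_apply, e2, Pi.smul_apply, e3, smul_eq_mul, hG]
  push_cast
  ring

end IsFormMultiplier

/-! ### Cutoff functions -/

lemma CompactlySupported.exists_bound {χ : ℝ → ℂ} (hχ : ContinuousOn χ (Ioi 0))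
    (hc : CompactlySupported χ) : ∃ C, ∀ x, 0 < x → ‖χ x‖ ≤ C := by
  obtain ⟨a, b, ha, h⟩ := hc
  obtain ⟨C, hC⟩ := (isCompact_Icc (a := a) (b := b)).exists_bound_of_continuousOn
    (hχ.mono fun x hx => lt_of_lt_of_le ha hx.1)
  refine ⟨max C 0, fun x hx => ?_⟩
  by_cases hxab : x ∈ Icc a b
  · exact (hC x hxab).trans (le_max_left _ _)
  · rw [h x hx hxab, norm_zero]
    exact le_max_right _ _

lemma MaxDomainFun.eqOn_deriv_mul {q : ℝ → ℝ} {f χ : ℝ → ℂ} (hf : MaxDomainFun q f)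
    (hχ : ContDiffOn ℝ ∞ χ (Ioi 0)) : EqOn (deriv fun x => χ x * f x)
      (fun x => deriv χ x * f x + χ x * deriv f x) (Ioi 0) := fun x hx =>
  (((hχ.differentiableOn (by simp) x hx).differentiableAt (Ioi_mem_nhds hx)).hasDerivAt.mul
    ((hf.diff x hx).differentiableAt (Ioi_mem_nhds hx)).hasDerivAt).deriv

lemma contDiffOn_deriv_Ioi {χ : ℝ → ℂ} (hχ : ContDiffOn ℝ ∞ χ (Ioi 0)) :
    ContDiffOn ℝ ∞ (deriv χ) (Ioi 0) :=
  ((contDiffOn_infty_iff_deriv_of_isOpen isOpen_Ioi).1 hχ).2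

/-- The maximal domain is invariant under multiplication by smooth cutoff functions. -/
lemma MaxDomainFun.cutoff {q : ℝ → ℝ} {f χ : ℝ → ℂ} (hf : MaxDomainFun q f)
    (hχ : ContDiffOn ℝ ∞ χ (Ioi 0)) (hc : CompactlySupported χ) :
    MaxDomainFun q (fun x => χ x * f x) := by
  have hχ' := contDiffOn_deriv_Ioi hχ
  have hχ'' := contDiffOn_deriv_Ioi hχ'
  have aχ : ACloc χ := acloc_of_contDiffOn (hχ.of_le (by simp))
  have aχ' : ACloc (deriv χ) := acloc_of_contDiffOn (hχ'.of_le (by simp))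
  have hd := hf.eqOn_deriv_mul hχ
  refine ⟨aχ.mul hf.ac, (hχ.differentiableOn (by simp)).mul hf.diff,
    ((aχ'.mul hf.ac).add (aχ.mul hf.ac_deriv)).congr hd.symm,
    memLp_of_compactlySupported (aχ.mul hf.ac).continuousOn (hc.mul_right f), ?_⟩
  obtain ⟨C, hC⟩ := hc.exists_bound hχ.continuousOn
  have m1 : MemLp (fun x => χ x * tau q f x) 2 halfLine := by
    refine hf.memLp_tau.of_le_mul (c := C)
      ((hχ.continuousOn.aestronglyMeasurable measurableSet_Ioi).mul
        hf.memLp_tau.aestronglyMeasurable) ?_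
    filter_upwards [ae_restrict_mem measurableSet_Ioi] with x hx
    rw [norm_mul]
    exact mul_le_mul_of_nonneg_right (hC x hx) (norm_nonneg _)
  have m2 : MemLp (fun x => deriv χ x * deriv f x) 2 halfLine :=
    memLp_of_compactlySupported (aχ'.mul hf.ac_deriv).continuousOn (hc.deriv.mul_right _)
  have m3 : MemLp (fun x => deriv (deriv χ) x * f x) 2 halfLine :=
    memLp_of_compactlySupported (hχ''.continuousOn.mul hf.ac.continuousOn)
      (hc.deriv.deriv.mul_right _)
  -- By the product rule, `τ(χ f) = χ τf - 2 χ' f' - χ'' f`.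
  refine (memLp_congr_ae ?_).1 ((m1.sub (m2.const_mul 2)).sub m3)
  filter_upwards [hf.ac_deriv.ae_differentiableAt, ae_restrict_mem measurableSet_Ioi] with x h1 hx
  have d1 : HasDerivAt χ (deriv χ x) x :=
    ((hχ.differentiableOn (by simp) x hx).differentiableAt (Ioi_mem_nhds hx)).hasDerivAt
  have d2 : HasDerivAt (deriv χ) (deriv (deriv χ) x) x :=
    ((hχ'.differentiableOn (by simp) x hx).differentiableAt (Ioi_mem_nhds hx)).hasDerivAt
  have d3 : HasDerivAt f (deriv f x) x :=
    ((hf.diff x hx).differentiableAt (Ioi_mem_nhds hx)).hasDerivAt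
  have e1 : deriv (deriv fun x => χ x * f x) x =
      (deriv (deriv χ) x * f x + deriv χ x * deriv f x) +
        (deriv χ x * deriv f x + χ x * deriv (deriv f) x) :=
    (deriv_eqOn_nhds hd hx).trans ((d2.mul d3).add (d1.mul h1.hasDerivAt)).deriv
  simp only [Pi.sub_apply, tau, e1]
  ring

/-- Cutoff functions with `‖x χₙ'‖ → 0`. -/
lemma exists_cutoff : ∃ χ : ℕ → ℝ → ℂ, ∃ C : ℝ, (∀ n, ContDiffOn ℝ ∞ (χ n) (Ioi 0)) ∧
    (∀ n, CompactlySupported (χ n)) ∧ (∀ n x, ‖χ n x‖ ≤ 1) ∧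
    (∀ x, 0 < x → ∀ᶠ n in atTop, χ n x = 1) ∧
    ∀ (n : ℕ) (x : ℝ), 0 < x → ‖(x : ℂ) * deriv (χ n) x‖ ≤ C / (n + 1) := by
  let η : ContDiffBump (0 : ℝ) := ⟨1, 2, one_pos, one_lt_two⟩
  have hη : ContDiff ℝ ∞ η := η.contDiff
  obtain ⟨C, hC⟩ := (hη.continuous_deriv (by simp)).bounded_above_of_compact_support
    η.hasCompactSupport.deriv
  have hpos : ∀ n : ℕ, (0 : ℝ) < n + 1 := fun n => by positivity
  -- The logarithmic scale cuts off at `0` and at `∞` simultaneously: `χₙ = 1` on `[e^{-(n+1)},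
  -- e^{n+1}]`, and `x χₙ'(x) = η'(log x / (n + 1)) / (n + 1)`.
  refine ⟨fun n x => ((η (Real.log x / (n + 1)) : ℝ) : ℂ), C, fun n => ?_, fun n => ?_,
    fun n x => ?_, fun x hx => ?_, fun n x hx => ?_⟩
  · refine Complex.ofRealCLM.contDiff.comp_contDiffOn (hη.comp_contDiffOn ?_)
    exact (contDiffOn_id.log fun x hx => ne_of_gt hx).div_const _
  · refine ⟨Real.exp (-(2 * (n + 1))), Real.exp (2 * (n + 1)), Real.exp_pos _, fun x hx hn => ?_⟩
    suffices h : η (Real.log x / (n + 1)) = 0 by simp [h]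
    refine η.zero_of_le_dist ?_
    change 2 ≤ dist _ _
    rw [dist_zero_right, Real.norm_eq_abs, abs_div, abs_of_pos (hpos n), le_div_iff₀ (hpos n)]
    by_contra hlt
    have := abs_lt.1 (not_le.1 hlt)
    exact hn ⟨(Real.le_log_iff_exp_le hx).1 this.1.le, (Real.log_le_iff_le_exp hx).1 this.2.le⟩
  · rw [Complex.norm_real, Real.norm_eq_abs, abs_of_nonneg η.nonneg]
    exact η.le_one
  · obtain ⟨N, hN⟩ := exists_nat_ge |Real.log x|
    filter_upwards [eventually_ge_atTop N] with n hn
    rw [η.one_of_mem_closedBall, Complex.ofReal_one]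
    change _ ∈ Metric.closedBall (0 : ℝ) 1
    rw [mem_closedBall_zero_iff, Real.norm_eq_abs, abs_div, abs_of_pos (hpos n),
      div_le_one (hpos n)]
    have : (N : ℝ) ≤ n := by exact_mod_cast hn
    linarith
  · have h1 : HasDerivAt (fun x : ℝ => Real.log x / (n + 1)) (x⁻¹ / (n + 1)) x :=
      (Real.hasDerivAt_log hx.ne').div_const _
    have h2 := ((hη.differentiable (by simp)) (Real.log x / (n + 1))).hasDerivAt.comp x h1
    have h3 := h2.ofReal_comp.deriv
    have h4 : deriv (fun x : ℝ => ((η (Real.log x / (n + 1)) : ℝ) : ℂ)) x =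
        ((deriv η (Real.log x / (n + 1)) * (x⁻¹ / (n + 1)) : ℝ) : ℂ) := h3
    rw [h4, ← Complex.ofReal_mul, Complex.norm_real]
    have h5 : x * (deriv η (Real.log x / (n + 1)) * (x⁻¹ / (n + 1))) =
        deriv η (Real.log x / (n + 1)) / (n + 1) := by
      field_simp
    rw [h5, norm_div, Real.norm_eq_abs ((n : ℝ) + 1), abs_of_pos (hpos n)]
    exact div_le_div_of_nonneg_right (hC _) (hpos n).le

/-- Dominated convergence in `L²(0, ∞)`. -/
lemma L2.tendsto_zero_of_dominated {D : ℕ → L2} {b : ℝ → ℝ} (hb : MemLp b 2 halfLine)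
    (hD : ∀ n, ∀ᵐ x ∂halfLine, ‖D n x‖ ≤ b x)
    (hlim : ∀ᵐ x ∂halfLine, Tendsto (fun n => D n x) atTop (𝓝 0)) :
    Tendsto (fun n => ‖D n‖ ^ 2) atTop (𝓝 0) := by
  simp only [L2.norm_sq_eq_integral]
  rw [← integral_zero ℝ ℝ (μ := halfLine)]
  refine tendsto_integral_of_dominated_convergence (fun x => b x ^ 2)
    (fun n => ((Lp.aestronglyMeasurable (D n)).norm.pow 2)) hb.integrable_sq (fun n => ?_) ?_
  · filter_upwards [hD n] with x hx
    rw [Real.norm_eq_abs, abs_of_nonneg (sq_nonneg _)]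
    exact pow_le_pow_left₀ (norm_nonneg _) hx 2
  · filter_upwards [hlim] with x hx
    simpa using hx.norm.pow 2

/-- The elements of the form domain that belong to the domain of the preminimal operator. -/
def preminimalSet (q : ℝ → ℝ) (γ : ℝ) (m : ℝ → ℝ) : Set (FormDomain γ m) :=
  {k | ∃ g, MaxDomainFun q g ∧ CompactlySupported g ∧ formEmbedding γ m k =ᵐ[halfLine] g}

/-- The approximants are `χₙ f`. Each component of the triple is multiplied by `χₙ`, except that the
middle one gains `χₙ' f = (x χₙ') (f/x)`. Since `x χₙ'` is bounded and tends to zero and `f/x ∈ L²`,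
dominated convergence gives convergence in all three components. -/
lemma IsFormMultiplier.mem_closure_preminimalSet {q : ℝ → ℝ} {μ γ : ℝ} {m : ℝ → ℝ}
    (hm : IsFormMultiplier q μ γ m) {k : FormDomain γ m} {f : ℝ → ℂ} (hf : MaxDomainFun q f)
    (hk : formEmbedding γ m k =ᵐ[halfLine] f) : k ∈ closure (preminimalSet q γ m) := by
  obtain ⟨χ, C, hχ, hc, hχ1, hχlim, hχ'⟩ := exists_cutoff
  have hg := fun n => hf.cutoff (hχ n) (hc n)
  have hgc := fun n => (hc n).mul_right f
  choose l hl using fun n => hm.exists_formDomain (hg n).ac (hgc n) ((hg n).memLp_deriv (hgc n))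
  refine mem_closure_of_tendsto (b := atTop) (f := l) ?_
    (Eventually.of_forall fun n => ⟨_, hg n, hgc n, hl n⟩)
  have hC : 0 ≤ C := by
    have := (norm_nonneg _).trans (hχ' 0 1 one_pos)
    simpa using this
  obtain ⟨u', h, h1, h2, h3⟩ := k.spec
  have hk : k.triple.fst =ᵐ[halfLine] f := hk
  have hu' := h1.isH10.deriv_ae_eq hf.ac hk
  choose v' j g1 g2 g3 using fun n => (l n).spec
  have hl : ∀ n, (l n).triple.fst =ᵐ[halfLine] fun x => χ n x * f x := hl
  have hv' := fun n => (g1 n).isH10.deriv_ae_eq (hg n).ac (hl n)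
  have a1 : ∀ n, ((l n).triple.fst - k.triple.fst : L2) =ᵐ[halfLine]
      fun x => (χ n x - 1) * k.triple.fst x := by
    intro n
    filter_upwards [Lp.coeFn_sub (l n).triple.fst k.triple.fst, hl n, hk] with x e1 e2 e3
    rw [e1, Pi.sub_apply, e2, e3]
    ring
  have a2 : ∀ n, ((l n).triple.snd.fst - k.triple.snd.fst : L2) =ᵐ[halfLine]
      fun x => (χ n x - 1) * k.triple.snd.fst x + (x * deriv (χ n) x) * h x := by
    intro n
    rw [g2 n, h2]
    filter_upwards [Lp.coeFn_sub (v' n - (γ : ℂ) • j n) (u' - (γ : ℂ) • h),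
      Lp.coeFn_sub (v' n) ((γ : ℂ) • j n), Lp.coeFn_sub u' ((γ : ℂ) • h),
      Lp.coeFn_smul (γ : ℂ) (j n), Lp.coeFn_smul (γ : ℂ) h, hl n, hk, hu', hv' n, h1.ae_eq,
      (g1 n).ae_eq, ae_restrict_mem measurableSet_Ioi]
      with x e1 e2 e3 e4 e5 e6 e7 e8 e9 e10 e11 hx
    have hxc : (x : ℂ) ≠ 0 := by exact_mod_cast (ne_of_gt hx)
    have e12 : deriv (fun x => χ n x * f x) x = deriv (χ n) x * f x + χ n x * deriv f x :=
      hf.eqOn_deriv_mul (hχ n) hx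
    simp only [e1, e2, e3, e4, e5, Pi.sub_apply, Pi.smul_apply, smul_eq_mul, e9, e12, e8, e11, e10,
      e6, e7]
    push_cast
    field_simp
    ring
  have a3 : ∀ n, ((l n).triple.snd.snd - k.triple.snd.snd : L2) =ᵐ[halfLine]
      fun x => (χ n x - 1) * k.triple.snd.snd x := by
    intro n
    filter_upwards [Lp.coeFn_sub (l n).triple.snd.snd k.triple.snd.snd, hl n, hk, h3, g3 n]
      with x e1 e2 e3 e4 e5
    rw [e1, Pi.sub_apply, e4, e5, e2, e3]
    ring
  have hχ2 : ∀ n x, ‖χ n x - 1‖ ≤ 2 := fun n x => by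
    refine (norm_sub_le _ _).trans ?_
    rw [norm_one]
    linarith [hχ1 n x]
  have hχ0 : ∀ x, 0 < x → Tendsto (fun n => χ n x - 1) atTop (𝓝 0) := fun x hx => by
    refine (tendsto_congr' ?_).2 tendsto_const_nhds
    filter_upwards [hχlim x hx] with n hn
    rw [hn, sub_self]
  have hχ'0 : ∀ x : ℝ, 0 < x → Tendsto (fun n => (x : ℂ) * deriv (χ n) x) atTop (𝓝 0) :=
    fun x hx => squeeze_zero_norm (fun n => hχ' n x hx)
      ((tendsto_const_nhds.div_atTop (tendsto_atTop_add_const_right _ _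
        tendsto_natCast_atTop_atTop)))
  have aux : ∀ (F : L2) (D : ℕ → L2), (∀ n, D n =ᵐ[halfLine] fun x => (χ n x - 1) * F x) →
      Tendsto (fun n => ‖D n‖ ^ 2) atTop (𝓝 0) := by
    intro F D hD
    refine L2.tendsto_zero_of_dominated ((Lp.memLp F).norm.const_mul 2) (fun n => ?_) ?_
    · filter_upwards [hD n] with x hx
      rw [hx, norm_mul]
      exact mul_le_mul_of_nonneg_right (hχ2 n x) (norm_nonneg _)
    · filter_upwards [ae_all_iff.2 hD, ae_restrict_mem measurableSet_Ioi] with x hx hpos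
      simp only [hx]
      simpa using (hχ0 x hpos).mul_const (F x)
  have b2 : Tendsto (fun n => ‖(l n).triple.snd.fst - k.triple.snd.fst‖ ^ 2) atTop (𝓝 0) := by
    refine L2.tendsto_zero_of_dominated (b := fun x => 2 * ‖k.triple.snd.fst x‖ + C * ‖h x‖)
      (((Lp.memLp k.triple.snd.fst).norm.const_mul 2).add ((Lp.memLp h).norm.const_mul C))
      (fun n => ?_) ?_
    · filter_upwards [a2 n, ae_restrict_mem measurableSet_Ioi] with x hx hpos
      rw [hx]
      refine (norm_add_le _ _).trans ?_
      rw [norm_mul, norm_mul]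
      refine add_le_add (mul_le_mul_of_nonneg_right (hχ2 n x) (norm_nonneg _))
        (mul_le_mul_of_nonneg_right ((hχ' n x hpos).trans (div_le_self hC ?_)) (norm_nonneg _))
      linarith [(Nat.cast_nonneg n : (0 : ℝ) ≤ n)]
    · filter_upwards [ae_all_iff.2 a2, ae_restrict_mem measurableSet_Ioi] with x hx hpos
      simp only [hx]
      simpa using ((hχ0 x hpos).mul_const (k.triple.snd.fst x)).add ((hχ'0 x hpos).mul_const (h x))
  rw [tendsto_iff_norm_sub_tendsto_zero]
  have hsq : Tendsto (fun n => ‖(l n).triple - k.triple‖ ^ 2) atTop (𝓝 0) := by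
    have := (aux _ _ a1).add (b2.add (aux _ _ a3))
    simp only [add_zero] at this
    refine this.congr fun n => ?_
    rw [WithLp.prod_norm_sq_eq_of_L2 ((l n).triple - k.triple), WithLp.prod_norm_sq_eq_of_L2]
    rfl
  have := hsq.sqrt
  simp only [Real.sqrt_zero] at this
  refine this.congr fun n => ?_
  rw [Real.sqrt_sq (norm_nonneg _)]
  rfl

/-- The domain of the preminimal operator is a form core. -/
lemma IsFormMultiplier.dense_preminimalSet {q : ℝ → ℝ} {μ γ : ℝ} {m : ℝ → ℝ}
    (hm : IsFormMultiplier q μ γ m) (hγ : 1 / 2 < γ) : Dense (preminimalSet q γ m) := by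
  have := FormDomain.completeSpace hγ m
  refine dense_of_forall_represented (formEmbedding_injective γ m) fun k F hF => ?_
  obtain ⟨f, hf, hk⟩ := hm.exists_maxDomainFun hF
  exact hm.mem_closure_preminimalSet hf hk

/-! ### The Friedrichs extension -/

namespace IsFormMultiplier

variable {q : ℝ → ℝ} {μ γ : ℝ} {m : ℝ → ℝ} (hm : IsFormMultiplier q μ γ m)
  [CompleteSpace (FormDomain γ m)]
include hm

/-- Integration by parts shows that `T'` is a restriction of the form operator. That operator is
closed, so it also extends the closure of `T'`. -/
lemma minimalOperator_le : minimalOperator q ≤ formOperator (formEmbedding γ m) (μ + 1) := by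
  have hJ := formEmbedding_injective γ m
  have hd := hm.denseRange_formEmbedding
  have hcl := isClosed_formOperator (lam := μ + 1) hJ hd
  have h1 : preminimalOperator q ≤ formOperator (formEmbedding γ m) (μ + 1) := by
    refine LinearPMap.le_of_le_graph ?_
    rintro ⟨u, w⟩ huw
    obtain ⟨g, hg, hc, hu, hw⟩ := (mem_graph_preminimalOperator q u w).1 huw
    obtain ⟨l, hl⟩ := hm.exists_formDomain hg.ac hc (hg.memLp_deriv hc)
    have hlu : formEmbedding γ m l = u := Lp.ext (hl.trans hu.symm)
    refine (mem_graph_formOperator_iff_exists hJ hd).2 ⟨l, hlu, fun k => ?_⟩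
    have := congrArg conj (hm.inner_eq_inner_tau_left (k := k) hg hc hl hw)
    rwa [inner_conj_symm, inner_conj_symm, hlu] at this
  refine (hcl.isClosable.closure_mono h1).trans_eq (LinearPMap.eq_of_eq_graph ?_)
  rw [← hcl.isClosable.graph_closure_eq_closure_graph]
  exact hcl.submodule_topologicalClosure_eq

/-- The lifts include the core `preminimalSet`: by injectivity of the embedding, the lift of `J l`
is `l` itself. -/
lemma denseRange_formLift (hγ : 1 / 2 < γ) :
    DenseRange (formLift (formEmbedding γ m) (μ + 1) (minimalOperator q)) := by
  refine (hm.dense_preminimalSet hγ).mono ?_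
  rintro l ⟨g, hg, hc, hl⟩
  have h1 : (formEmbedding γ m l, hg.memLp_tau.toLp _) ∈ (preminimalOperator q).graph :=
    (mem_graph_preminimalOperator q _ _).2 ⟨g, hg, hc, hl, hg.memLp_tau.coeFn_toLp⟩
  have h2 : formEmbedding γ m l ∈ (minimalOperator q).domain :=
    (preminimalOperator q).le_closure.1 (LinearPMap.mem_domain_of_mem_graph h1)
  refine ⟨⟨_, h2⟩, formEmbedding_injective γ m ?_⟩
  exact apply_formLift (formEmbedding_injective γ m) hm.denseRange_formEmbedding
    hm.minimalOperator_le _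

/-- One inclusion is the regularity of represented elements. For the other, `τ f` represents `k`
against compactly supported `g`, where no boundary terms arise; the identity is continuous in `l`
and extends from the core by density. -/
lemma domain_formOperator (hγ : 1 / 2 < γ) :
    ((formOperator (formEmbedding γ m) (μ + 1)).domain : Set L2) = maxDomain q ∩ H10q q := by
  have hJ := formEmbedding_injective γ m
  have hd := hm.denseRange_formEmbedding
  rw [← hm.range_formEmbedding]
  ext u
  constructor
  · intro hu
    obtain ⟨k, rfl, hk⟩ := (mem_graph_formOperator_iff_exists hJ hd).1
      ((formOperator (formEmbedding γ m) (μ + 1)).mem_graph ⟨u, hu⟩)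
    exact ⟨hm.exists_maxDomainFun hk, k, rfl⟩
  · rintro ⟨⟨f, hf, hu⟩, k, rfl⟩
    refine LinearPMap.mem_domain_of_mem_graph (y := hf.memLp_tau.toLp _)
      ((mem_graph_formOperator_iff_exists hJ hd).2 ⟨k, rfl, fun l => ?_⟩)
    have hcl : IsClosed {l : FormDomain γ m | ⟪l, k⟫_ℂ = ⟪formEmbedding γ m l,
        hf.memLp_tau.toLp _ + ((μ + 1 : ℝ) : ℂ) • formEmbedding γ m k⟫_ℂ} :=
      isClosed_eq (by fun_prop) (by fun_prop)
    refine closure_minimal ?_ hcl (hm.dense_preminimalSet hγ l)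
    rintro l ⟨g, hg, hc, hl⟩
    exact hm.inner_eq_inner_tau_right hf hg.ac hc hu hl hf.memLp_tau.coeFn_toLp

end IsFormMultiplier

/-! ### Choice of the parameters and conclusion -/

/-- Here `γ` is the larger root of `γ² - γ = β`, and the lower bound on `q` makes the radicand of
`m` nonnegative almost everywhere. -/
lemma isFormMultiplier_sqrt {q : ℝ → ℝ} (hq : LocallyIntegrableOn q (Ioi (0 : ℝ))) {β μ : ℝ}
    (hβ : -(1 / 4) < β) (hqβ : ∀ᵐ x ∂halfLine, β / x ^ 2 - μ ≤ q x) :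
    IsFormMultiplier q μ (1 / 2 + √(1 / 4 + β)) fun x => √(q x + μ - β * (x⁻¹) ^ 2) where
  locallyIntegrableOn := hq
  aestronglyMeasurable := by
    refine Real.continuous_sqrt.comp_aestronglyMeasurable ?_
    refine (hq.aestronglyMeasurable.add aestronglyMeasurable_const).sub ?_
    exact ((measurable_inv.pow_const 2).const_mul β).aestronglyMeasurable
  sq_eq := by
    filter_upwards [hqβ] with x hx
    have h1 : √(1 / 4 + β) ^ 2 = 1 / 4 + β := Real.sq_sqrt (by linarith)
    have h2 : (1 / 2 + √(1 / 4 + β)) ^ 2 - (1 / 2 + √(1 / 4 + β)) = β := by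
      linear_combination h1
    rw [h2, Real.sq_sqrt]
    rw [inv_pow, ← div_eq_mul_inv]
    linarith

end SturmLiouville

end

theorem corollary7p1 (q : ℝ → ℝ) (hq : LocallyIntegrableOn q (Set.Ioi (0 : ℝ)))
    (β μ : ℝ) (hβ : -(1 / 4) < β) (hμ : 0 ≤ μ)
    (hqβ : ∀ᵐ x ∂SturmLiouville.halfLine, β / x ^ 2 - μ ≤ q x) :
    (SturmLiouville.formClosureDomain (SturmLiouville.minimalOperator q) =
        SturmLiouville.H10q q ∧
      ∀ u u' : SturmLiouville.L2, SturmLiouville.IsH10 u u' → u ∈ SturmLiouville.H10q q →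
        ∀ s, SturmLiouville.FormTendsto (SturmLiouville.minimalOperator q) s u →
          Tendsto (fun n => SturmLiouville.opForm (SturmLiouville.minimalOperator q) (s n) (s n))
            atTop (𝓝 (((∫ x in Set.Ioi (0 : ℝ), ‖u' x‖ ^ 2) +
              ∫ x in Set.Ioi (0 : ℝ), q x * ‖u x‖ ^ 2 : ℝ) : ℂ))) ∧
    ((∃! A, SturmLiouville.IsFriedrichsExtension (SturmLiouville.minimalOperator q) A) ∧
      ∀ A, SturmLiouville.IsFriedrichsExtension (SturmLiouville.minimalOperator q) A →
        (A.domain : Set SturmLiouville.L2) =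
          SturmLiouville.maxDomain q ∩ SturmLiouville.H10q q) := by
  have hm := SturmLiouville.isFormMultiplier_sqrt hq hβ hqβ
  set γ := 1 / 2 + √(1 / 4 + β) with hγdef
  set m := fun x => √(q x + μ - β * (x⁻¹) ^ 2)
  have hγ : 1 / 2 < γ := by
    have : 0 < √(1 / 4 + β) := Real.sqrt_pos.2 (by linarith)
    rw [hγdef]
    linarith
  have := SturmLiouville.FormDomain.completeSpace hγ m
  have hJ := SturmLiouville.formEmbedding_injective γ m
  have hd := hm.denseRange_formEmbedding
  have hT := hm.minimalOperator_le
  have hT' := hm.denseRange_formLift hγ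
  have hF := SturmLiouville.isFriedrichsExtension_formOperator hJ hd hT hT'
  refine ⟨⟨?_, ?_⟩, ⟨_, hF, fun A hA => hA.unique hF⟩, fun A hA => ?_⟩
  · rw [SturmLiouville.formClosureDomain_eq_range hJ hd hT hT', hm.range_formEmbedding]
  · intro u u' hu hq s hs
    rw [← hm.range_formEmbedding] at hq
    obtain ⟨k, rfl⟩ := hq
    -- The limit is `‖k‖² - (μ + 1) ‖J k‖²`, and the shift cancels by `norm_sq_eq`.
    refine (SturmLiouville.tendsto_opForm hJ hd hT hs hs).trans_eq ?_
    congr 1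
    rw [inner_self_eq_norm_sq_to_K, inner_self_eq_norm_sq_to_K]
    have h1 := hm.norm_sq_eq k hu
    have h2 : (∫ x in Set.Ioi (0 : ℝ), ‖u' x‖ ^ 2) +
        ∫ x in Set.Ioi (0 : ℝ), q x * ‖SturmLiouville.formEmbedding γ m k x‖ ^ 2 =
        ‖k‖ ^ 2 - (μ + 1) * ‖SturmLiouville.formEmbedding γ m k‖ ^ 2 := by
      rw [h1]
      ring
    rw [h2]
    push_cast
    rfl
  · rw [hA.unique hF, hm.domain_formOperator hγ]
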